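/- **Conventions.** For a category $\mathcal C$ with finite colimits and a choice of finite coproducts, $(\mathcal C,+)$ denotes the resulting symmetric monoidal category, with unit the initial object $\varnothing$; $!$ denotes the unique map out of $\varnothing$. Let $(F,\varphi)\colon(\mathcal C,+)\to(\mathcal D,\otimes)$ be a lax braided monoidal functor to a braided monoidal category. An *$F$-decorated cospan* from $X$ to $Y$ is a cospan $X\xrightarrow{i}N\xleftarrow{o}Y$ in $\mathcal C$ together with a morphism $s\colon 1_{\mathcal D}\to FN$ (its decoration); two are isomorphic if there is an isomorphism of apices compatible with the legs and the decorations. The *empty decoration* on $N$ is $1_{\mathcal D}\xrightarrow{\varphi_1}F\varnothing\xrightarrow{F!}FN$. The category $F\mathrm{Cospan}$ has the objects of $\mathcal C$ as objects and isomorphism classes of $F$-decorated cospans as morphisms; composition is by pushout of cospans, with decoration $$1\xrightarrow{\lambda^{-1}}1\otimes1\xrightarrow{s\otimes t}FN\otimes FM\xrightarrow{\varphi_{N,M}}F(N+M)\xrightarrow{F[j_N,j_M]}F(N+_YM),$$ and the identity of $X$ is the identity cospan with empty decoration. The monoidal product is $+$ on objects and the coproduct of cospans with decoration $\varphi_{N,N'}\circ(s\otimes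 t)\circ\lambda^{-1}$ on morphisms. Each map $f\colon X\to Y$ of $\mathcal C$ is viewed as the cospan $X\xrightarrow{f}Y\xleftarrow{1}Y$ with empty decoration; the associator, unitors and braiding are those of $(\mathcal C,+)$, and each object $X$ carries the special commutative Frobenius monoid whose multiplication and unit are $[1_X,1_X]\colon X+X\to X$ and $!\colon\varnothing\to X$, and whose comultiplication and counit are the opposite cospans. This makes $F\mathrm{Cospan}$ a *hypergraph category*: a symmetric monoidal category in which each object carries a special commutative Frobenius monoid structure $(X,\mu_X,\delta_X,\eta_X,\epsilon_X)$, with $$\mu_{X\otimes Y}=(\mu_X\otimes\mu_Y)(1\otimes\sigma_{Y,X}\otimes1),\quad \eta_{X\otimes Y}=\eta_X\otimes\eta_Y,\quad \delta_{X\otimes Y}=(1\otimes\sigma_{X,Y}\otimes1)(\delta_X\otimes\delta_Y),\quad \epsilon_{X\otimes Y}=\epsilon_X\otimes\epsilon_Y.$$ A *hypergraph functor* is a strong symmetric monoidal functor $(T,\tau)$ between hypergraph categories such that, for every $X$, the structure on $TX$ is $$(TX,\;T\mu_X\circ\tau_{X,X},\;\tau_{X,X}^{-1}\circ T\delta_X,\;T\eta_X\circ\tau_1,\;\tau_1^{-1}\circ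 T\epsilon_X).$$ A lax monoidal functor is *strict* if all its coherence maps (binary and unit) are identities. **Theorem 4.1.** Let $\mathcal C,\mathcal C'$ be categories with finite colimits (and chosen finite coproducts, written $+$), and let $(\mathcal D,\otimes),(\mathcal D',\boxtimes)$ be braided monoidal categories. Let $(F,\varphi)\colon(\mathcal C,+)\to(\mathcal D,\otimes)$ and $(G,\gamma)\colon(\mathcal C',+)\to(\mathcal D',\boxtimes)$ be lax braided monoidal functors. Let $A\colon\mathcal C\to\mathcal C'$ be a functor preserving finite colimits, made into a strong monoidal functor $(A,\alpha)\colon(\mathcal C,+)\to(\mathcal C',+)$ by the canonical isomorphisms $\alpha_{X,Y}\colon AX+AY\to A(X+Y)$ and $\alpha_1\colon\varnothing\to A\varnothing$; let $(B,\beta)\colon(\mathcal D,\otimes)\to(\mathcal D',\boxtimes)$ be a lax monoidal functor; and let $\theta\colon B\circ F\Rightarrow G\circ A$ be a monoidal natural transformation between the composite lax monoidal functors. Then the assignment sending an object $X$ to $AX$ and the class of $$\bigl(X\xrightarrow{i}N\xleftarrow{o}Y,\ 1_{\mathcal D}\xrightarrow{s}FN\bigr)$$ to the class of $$\bigl(AX\xrightarrow{Ai}AN\xleftarrow{Ao}AY,\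 1_{\mathcal D'}\xrightarrow{\beta_1}B1_{\mathcal D}\xrightarrow{Bs}BFN\xrightarrow{\theta_N}GAN\bigr)$$ is a functor $T\colon F\mathrm{Cospan}\to G\mathrm{Cospan}$, and it underlies a hypergraph functor $(T,\tau)$ whose coherence maps $\tau_1,\tau_{X,Y}$ are $\alpha_1,\alpha_{X,Y}$ viewed as cospans with empty decoration. Moreover, $(T,\tau)$ is a strict monoidal functor if and only if $(A,\alpha)$ is. -/

import Mathlib

open CategoryTheory CategoryTheory.Limits MonoidalCategory

universe v₁ v₂ v₃ v₄ u₁ u₂ u₃ u₄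

/-- A symmetric monoidal category is cocartesian, that is, it is of the form `(C, +)` for a choice
of finite coproducts, if its unit is initial and the canonical maps
`X ≅ X ⊗ 𝟙_ C ⟶ X ⊗ Y ⟵ 𝟙_ C ⊗ Y ≅ Y` form a coproduct cocone. -/
class CocartesianMonoidal (C : Type u₁) [Category.{v₁} C] [MonoidalCategory C]
    [SymmetricCategory C] : Prop where
  unit_isInitial : Nonempty (IsInitial (𝟙_ C))
  tensor_isCoproduct (X Y : C) (f : 𝟙_ C ⟶ X) (g : 𝟙_ C ⟶ Y) :
    Nonempty (IsColimit (BinaryCofan.mk ((ρ_ X).inv ≫ X ◁ g) ((λ_ Y).inv ≫ f ▷ Y)))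

namespace CocartesianMonoidal

noncomputable section

variable {C : Type u₁} [Category.{v₁} C] [MonoidalCategory C] [SymmetricCategory C]
  [CocartesianMonoidal C]

/-- The unique map `! : ∅ ⟶ X`. -/
def fromUnit (X : C) : 𝟙_ C ⟶ X := (unit_isInitial (C := C)).some.to X

theorem unit_hom_ext {X : C} (f g : 𝟙_ C ⟶ X) : f = g :=
  (unit_isInitial (C := C)).some.hom_ext f g

/-- The first coproduct inclusion. -/
def inl (X Y : C) : X ⟶ X ⊗ Y := (ρ_ X).inv ≫ X ◁ fromUnit Y

/-- The second coproduct inclusion. -/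
def inr (X Y : C) : Y ⟶ X ⊗ Y := (λ_ Y).inv ≫ fromUnit X ▷ Y

/-- The universal property of the coproduct. -/
def isCoproduct (X Y : C) : IsColimit (BinaryCofan.mk (inl X Y) (inr X Y)) :=
  (tensor_isCoproduct X Y (fromUnit X) (fromUnit Y)).some

/-- The copairing `[f, g] : X + Y ⟶ Z`. -/
def desc {X Y Z : C} (f : X ⟶ Z) (g : Y ⟶ Z) : X ⊗ Y ⟶ Z :=
  (isCoproduct X Y).desc (BinaryCofan.mk f g)

theorem inl_desc {X Y Z : C} (f : X ⟶ Z) (g : Y ⟶ Z) : inl X Y ≫ desc f g = f :=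
  (isCoproduct X Y).fac _ ⟨WalkingPair.left⟩

theorem inr_desc {X Y Z : C} (f : X ⟶ Z) (g : Y ⟶ Z) : inr X Y ≫ desc f g = g :=
  (isCoproduct X Y).fac _ ⟨WalkingPair.right⟩

theorem tensor_hom_ext {X Y Z : C} {f g : X ⊗ Y ⟶ Z} (h₁ : inl X Y ≫ f = inl X Y ≫ g)
    (h₂ : inr X Y ≫ f = inr X Y ≫ g) : f = g :=
  BinaryCofan.IsColimit.hom_ext (isCoproduct X Y) h₁ h₂

theorem inl_tensorHom {X Y X' Y' : C} (f : X ⟶ X') (g : Y ⟶ Y') :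
    inl X Y ≫ (f ⊗ₘ g) = f ≫ inl X' Y' := by
  have : fromUnit Y ≫ g = fromUnit Y' := unit_hom_ext _ _
  simp only [inl, MonoidalCategory.tensorHom_def', ← this, Category.assoc,
    MonoidalCategory.whiskerLeft_comp, rightUnitor_inv_naturality_assoc, ← whisker_exchange_assoc,
    ← whisker_exchange]

theorem inr_tensorHom {X Y X' Y' : C} (f : X ⟶ X') (g : Y ⟶ Y') :
    inr X Y ≫ (f ⊗ₘ g) = g ≫ inr X' Y' := by
  have : fromUnit X ≫ f = fromUnit X' := unit_hom_ext _ _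
  simp only [inr, MonoidalCategory.tensorHom_def, ← this, Category.assoc,
    MonoidalCategory.comp_whiskerRight, leftUnitor_inv_naturality_assoc, whisker_exchange_assoc,
    whisker_exchange]

theorem inl_whiskerLeft (X : C) {Y Y' : C} (g : Y ⟶ Y') :
    inl X Y ≫ X ◁ g = inl X Y' := by
  simpa using inl_tensorHom (𝟙 X) g

theorem inr_whiskerLeft (X : C) {Y Y' : C} (g : Y ⟶ Y') :
    inr X Y ≫ X ◁ g = g ≫ inr X Y' := by
  simpa using inr_tensorHom (𝟙 X) g

theorem inl_whiskerRight {X X' : C} (f : X ⟶ X') (Y : C) :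
    inl X Y ≫ f ▷ Y = f ≫ inl X' Y := by
  simpa using inl_tensorHom f (𝟙 Y)

theorem inr_whiskerRight {X X' : C} (f : X ⟶ X') (Y : C) :
    inr X Y ≫ f ▷ Y = inr X' Y := by
  simpa using inr_tensorHom f (𝟙 Y)

theorem inl_rightUnitor (X : C) : inl X (𝟙_ C) ≫ (ρ_ X).hom = 𝟙 X := by
  have : fromUnit (𝟙_ C) = 𝟙 _ := unit_hom_ext _ _
  simp [inl, this]

theorem inr_leftUnitor (X : C) : inr (𝟙_ C) X ≫ (λ_ X).hom = 𝟙 X := by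
  have : fromUnit (𝟙_ C) = 𝟙 _ := unit_hom_ext _ _
  simp [inr, this]

theorem inl_associator (X Y Z : C) :
    inl (X ⊗ Y) Z ≫ (α_ X Y Z).hom = X ◁ inl Y Z := by
  simp [inl]

theorem inr_associator (X Y Z : C) :
    inr (X ⊗ Y) Z ≫ (α_ X Y Z).hom = inr Y Z ≫ inr X (Y ⊗ Z) := by
  have h : fromUnit (X ⊗ Y) = (λ_ (𝟙_ C)).inv ≫ fromUnit X ▷ _ ≫ X ◁ fromUnit Y :=
    unit_hom_ext _ _
  have h2 : inr Y Z ≫ inr X (Y ⊗ Z) =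
    (λ_ Z).inv ≫ (λ_ (𝟙_ C ⊗ Z)).inv ≫ fromUnit X ▷ _ ≫ X ◁ fromUnit Y ▷ Z := by
    simp only [inr, Category.assoc, leftUnitor_inv_naturality_assoc, whisker_exchange_assoc,
      MonoidalCategory.whiskerLeft_comp, whisker_exchange]
  rw [h2]
  simp [inr, h]

theorem inl_braiding (X Y : C) : inl X Y ≫ (β_ X Y).hom = inr Y X := by
  simp [inl, inr]

theorem inr_braiding (X Y : C) : inr X Y ≫ (β_ X Y).hom = inl Y X := by
  simp [inl, inr]

theorem inl_inl_associator (X Y Z : C) :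
    inl X Y ≫ inl (X ⊗ Y) Z ≫ (α_ X Y Z).hom = inl X (Y ⊗ Z) := by
  rw [inl_associator, inl_whiskerLeft]

theorem inr_inl_associator (X Y Z : C) :
    inr X Y ≫ inl (X ⊗ Y) Z ≫ (α_ X Y Z).hom = inl Y Z ≫ inr X (Y ⊗ Z) := by
  rw [inl_associator, inr_whiskerLeft]

theorem tensorHom_desc {X Y X' Y' Z : C} (f : X ⟶ X') (g : Y ⟶ Y') (h : X' ⟶ Z) (k : Y' ⟶ Z) :
    (f ⊗ₘ g) ≫ desc h k = desc (f ≫ h) (g ≫ k) := by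
  apply tensor_hom_ext
  · rw [reassoc_of% inl_tensorHom, inl_desc, inl_desc]
  · rw [reassoc_of% inr_tensorHom, inr_desc, inr_desc]

theorem desc_comp {X Y Z W : C} (f : X ⟶ Z) (g : Y ⟶ Z) (h : Z ⟶ W) :
    desc f g ≫ h = desc (f ≫ h) (g ≫ h) := by
  apply tensor_hom_ext
  · rw [reassoc_of% inl_desc, inl_desc]
  · rw [reassoc_of% inr_desc, inr_desc]

theorem isPushout_tensor {X N M P X' N' M' P' : C} {f : X ⟶ N} {g : X ⟶ M} {j : N ⟶ P}
    {k : M ⟶ P} {f' : X' ⟶ N'} {g' : X' ⟶ M'} {j' : N' ⟶ P'} {k' : M' ⟶ P'}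
    (sq : IsPushout f g j k) (sq' : IsPushout f' g' j' k') :
    IsPushout (f ⊗ₘ f') (g ⊗ₘ g') (j ⊗ₘ j') (k ⊗ₘ k') := by
  refine ⟨⟨?_⟩, ⟨PushoutCocone.IsColimit.mk _ (fun c => desc
    (sq.desc (inl _ _ ≫ c.inl) (inl _ _ ≫ c.inr) ?_)
    (sq'.desc (inr _ _ ≫ c.inl) (inr _ _ ≫ c.inr) ?_)) ?_ ?_ ?_⟩⟩
  · rw [MonoidalCategory.tensorHom_comp_tensorHom, MonoidalCategory.tensorHom_comp_tensorHom,
      sq.w, sq'.w]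
  · have := inl X X' ≫= c.condition
    rwa [reassoc_of% inl_tensorHom, reassoc_of% inl_tensorHom] at this
  · have := inr X X' ≫= c.condition
    rwa [reassoc_of% inr_tensorHom, reassoc_of% inr_tensorHom] at this
  · intro c
    apply tensor_hom_ext
    · rw [reassoc_of% inl_tensorHom, inl_desc, sq.inl_desc]
    · rw [reassoc_of% inr_tensorHom, inr_desc, sq'.inl_desc]
  · intro c
    apply tensor_hom_ext
    · rw [reassoc_of% inl_tensorHom, inl_desc, sq.inr_desc]
    · rw [reassoc_of% inr_tensorHom, inr_desc, sq'.inr_desc]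
  · intro c m h₁ h₂
    apply tensor_hom_ext
    · rw [inl_desc]
      apply sq.hom_ext
      · rw [sq.inl_desc, ← h₁, reassoc_of% inl_tensorHom]
      · rw [sq.inr_desc, ← h₂, reassoc_of% inl_tensorHom]
    · rw [inr_desc]
      apply sq'.hom_ext
      · rw [sq'.inl_desc, ← h₁, reassoc_of% inr_tensorHom]
      · rw [sq'.inr_desc, ← h₂, reassoc_of% inr_tensorHom]

/-- The codiagonal `[1, 1] : X + X ⟶ X`. -/
def codiag (X : C) : X ⊗ X ⟶ X := desc (𝟙 X) (𝟙 X)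

theorem inl_codiag (X : C) : inl X X ≫ codiag X = 𝟙 X := inl_desc _ _

theorem inr_codiag (X : C) : inr X X ≫ codiag X = 𝟙 X := inr_desc _ _

theorem fromUnit_whiskerRight_codiag (X : C) : fromUnit X ▷ X ≫ codiag X = (λ_ X).hom := by
  apply tensor_hom_ext
  · exact unit_hom_ext _ _
  · rw [reassoc_of% inr_whiskerRight, inr_codiag, inr_leftUnitor]

theorem whiskerLeft_fromUnit_codiag (X : C) : X ◁ fromUnit X ≫ codiag X = (ρ_ X).hom := by
  apply tensor_hom_ext
  · rw [reassoc_of% inl_whiskerLeft, inl_codiag, inl_rightUnitor]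
  · exact unit_hom_ext _ _

theorem codiag_assoc (X : C) :
    codiag X ▷ X ≫ codiag X = (α_ X X X).hom ≫ X ◁ codiag X ≫ codiag X := by
  apply tensor_hom_ext
  · rw [reassoc_of% inl_whiskerRight, inl_codiag, Category.comp_id]
    apply tensor_hom_ext
    · rw [inl_codiag, reassoc_of% inl_inl_associator, reassoc_of% inl_whiskerLeft, inl_codiag]
    · rw [inr_codiag, reassoc_of% inr_inl_associator, reassoc_of% inr_whiskerLeft, inr_codiag,
        Category.comp_id, inl_codiag]
  · rw [reassoc_of% inr_whiskerRight, inr_codiag, reassoc_of% inr_associator,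
      reassoc_of% inr_whiskerLeft, inr_codiag, Category.comp_id, inr_codiag]

theorem braiding_codiag (X : C) : (β_ X X).hom ≫ codiag X = codiag X := by
  apply tensor_hom_ext
  · rw [reassoc_of% inl_braiding, inr_codiag, inl_codiag]
  · rw [reassoc_of% inr_braiding, inr_codiag, inl_codiag]

theorem codiag_special (X : C) : IsPushout (codiag X) (codiag X) (𝟙 X) (𝟙 X) := by
  refine ⟨⟨rfl⟩, ⟨PushoutCocone.IsColimit.mk _ (fun c => c.inl) ?_ ?_ ?_⟩⟩
  · intro c
    exact Category.id_comp _
  · intro c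
    have := inl _ _ ≫= c.condition
    rw [reassoc_of% inl_codiag, reassoc_of% inl_codiag] at this
    rw [Category.id_comp, this]
  · intro c m h₁ _
    rw [← h₁, Category.id_comp]

theorem codiag_frobenius_left (X : C) :
    IsPushout (codiag X ▷ X) ((α_ X X X).hom ≫ X ◁ codiag X) (codiag X) (codiag X) := by
  refine ⟨⟨?_⟩, ⟨PushoutCocone.IsColimit.mk _ (fun c => inl _ _ ≫ c.inl) ?_ ?_ ?_⟩⟩
  · rw [codiag_assoc, Category.assoc]
  all_goals intro c
  · have h := c.condition
    have h₂ := inr X X ≫= inl (X ⊗ X) X ≫= h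
    have h₃ := inr (X ⊗ X) X ≫= h
    rw [Category.assoc] at h₂ h₃
    rw [reassoc_of% inl_whiskerRight, reassoc_of% inr_codiag, reassoc_of% inr_inl_associator,
      reassoc_of% inr_whiskerLeft, reassoc_of% inl_codiag] at h₂
    rw [reassoc_of% inr_whiskerRight, reassoc_of% inr_associator, reassoc_of% inr_whiskerLeft,
      reassoc_of% inr_codiag] at h₃
    apply tensor_hom_ext
    · rw [reassoc_of% inl_codiag]
    · rw [reassoc_of% inr_codiag, h₂, h₃]
  · have h := c.condition
    have h₁ := inl X X ≫= inl (X ⊗ X) X ≫= h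
    have h₂ := inr X X ≫= inl (X ⊗ X) X ≫= h
    rw [Category.assoc] at h₁ h₂
    rw [reassoc_of% inl_whiskerRight, reassoc_of% inl_codiag, reassoc_of% inl_inl_associator,
      reassoc_of% inl_whiskerLeft] at h₁
    rw [reassoc_of% inl_whiskerRight, reassoc_of% inr_codiag, reassoc_of% inr_inl_associator,
      reassoc_of% inr_whiskerLeft, reassoc_of% inl_codiag] at h₂
    apply tensor_hom_ext
    · rw [reassoc_of% inl_codiag, h₁]
    · rw [reassoc_of% inr_codiag, h₂]
  · intro m h₁ _
    rw [← h₁, reassoc_of% inl_codiag]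

theorem codiag_frobenius_right (X : C) :
    IsPushout (X ◁ codiag X) ((α_ X X X).inv ≫ codiag X ▷ X) (codiag X) (codiag X) := by
  refine (codiag_frobenius_left X).flip.of_iso (α_ X X X) (Iso.refl _) (Iso.refl _) (Iso.refl _)
    ?_ ?_ ?_ ?_
  · rw [Iso.refl_hom, Category.comp_id]
  · rw [Iso.refl_hom, Category.comp_id, Iso.hom_inv_id_assoc]
  · rw [Iso.refl_hom, Iso.refl_hom, Category.comp_id, Category.id_comp]
  · rw [Iso.refl_hom, Iso.refl_hom, Category.comp_id, Category.id_comp]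

theorem inl_associator_inv (X Y Z : C) :
    inl X (Y ⊗ Z) ≫ (α_ X Y Z).inv = inl X Y ≫ inl (X ⊗ Y) Z := by
  rw [Iso.comp_inv_eq, Category.assoc, inl_inl_associator]

theorem inr_associator_inv (X Y Z : C) :
    inr X (Y ⊗ Z) ≫ (α_ X Y Z).inv = inr X Y ▷ Z := by
  rw [Iso.comp_inv_eq]
  apply tensor_hom_ext
  · rw [reassoc_of% inl_whiskerRight, inr_inl_associator]
  · rw [reassoc_of% inr_whiskerRight, inr_associator]

theorem tensorμ_codiag (X Y : C) :
    tensorμ X Y X Y ≫ (codiag X ⊗ₘ codiag Y) = codiag (X ⊗ Y) := by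
  rw [tensorμ]
  apply tensor_hom_ext <;> apply tensor_hom_ext <;>
  simp only [Category.assoc, inl_codiag, inr_codiag, reassoc_of% inl_associator,
    reassoc_of% inr_associator, reassoc_of% inl_whiskerLeft, reassoc_of% inr_whiskerLeft,
    reassoc_of% inl_whiskerRight, reassoc_of% inr_whiskerRight, reassoc_of% inl_associator_inv,
    reassoc_of% inr_associator_inv, inl_tensorHom, inr_tensorHom, reassoc_of% inl_codiag,
    reassoc_of% inr_codiag, reassoc_of% inl_braiding, reassoc_of% inr_braiding,
    Category.comp_id]

theorem tensorδ_codiag (X Y : C) :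
    tensorδ X X Y Y ≫ (codiag X ⊗ₘ codiag Y) = codiag (X ⊗ Y) := by
  rw [← tensorμ_codiag, tensorδ, tensorμ, SymmetricCategory.braiding_swap_eq_inv_braiding]

theorem fromUnit_tensor (X Y : C) :
    (λ_ (𝟙_ C)).inv ≫ (fromUnit X ⊗ₘ fromUnit Y) = fromUnit (X ⊗ Y) := unit_hom_ext _ _

section Functor

variable {C' : Type u₂} [Category.{v₂} C'] (A : C ⥤ C') [PreservesFiniteColimits A]

/-- The image under `A` of a coproduct cocone is a coproduct cocone. -/
def mapIsCoproduct (X Y : C) :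
    IsColimit (BinaryCofan.mk (A.map (inl X Y)) (A.map (inr X Y))) :=
  mapIsColimitOfPreservesOfIsColimit A _ _ (isCoproduct X Y)

/-- The map out of `A(X + Y)` induced by maps out of `AX` and `AY`. -/
def mapDesc {X Y : C} {Z : C'} (f : A.obj X ⟶ Z) (g : A.obj Y ⟶ Z) : A.obj (X ⊗ Y) ⟶ Z :=
  (mapIsCoproduct A X Y).desc (BinaryCofan.mk f g)

theorem map_inl_mapDesc {X Y : C} {Z : C'} (f : A.obj X ⟶ Z) (g : A.obj Y ⟶ Z) :
    A.map (inl X Y) ≫ mapDesc A f g = f :=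
  (mapIsCoproduct A X Y).fac _ ⟨WalkingPair.left⟩

theorem map_inr_mapDesc {X Y : C} {Z : C'} (f : A.obj X ⟶ Z) (g : A.obj Y ⟶ Z) :
    A.map (inr X Y) ≫ mapDesc A f g = g :=
  (mapIsCoproduct A X Y).fac _ ⟨WalkingPair.right⟩

variable [MonoidalCategory C'] [SymmetricCategory C'] [CocartesianMonoidal C']

/-- The canonical isomorphism `α_{X,Y} = [A inl, A inr] : AX + AY ≅ A(X + Y)`. -/
def mapCoproductIso (X Y : C) : A.obj X ⊗ A.obj Y ≅ A.obj (X ⊗ Y) where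
  hom := desc (A.map (inl X Y)) (A.map (inr X Y))
  inv := mapDesc A (inl _ _) (inr _ _)
  hom_inv_id := by
    apply tensor_hom_ext
    · rw [reassoc_of% inl_desc, map_inl_mapDesc, Category.comp_id]
    · rw [reassoc_of% inr_desc, map_inr_mapDesc, Category.comp_id]
  inv_hom_id := by
    apply BinaryCofan.IsColimit.hom_ext (mapIsCoproduct A X Y)
    · change A.map (inl X Y) ≫ _ = A.map (inl X Y) ≫ _
      rw [reassoc_of% map_inl_mapDesc, inl_desc, Category.comp_id]
    · change A.map (inr X Y) ≫ _ = A.map (inr X Y) ≫ _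
      rw [reassoc_of% map_inr_mapDesc, inr_desc, Category.comp_id]

/-- The canonical isomorphism `α_1 : ∅ ≅ A∅`. -/
def mapUnitIso : 𝟙_ C' ≅ A.obj (𝟙_ C) :=
  (unit_isInitial (C := C')).some.uniqueUpToIso
    (IsInitial.isInitialObj A _ (unit_isInitial (C := C)).some)

theorem inl_mapCoproductIso (X Y : C) :
    inl _ _ ≫ (mapCoproductIso A X Y).hom = A.map (inl X Y) := inl_desc _ _

theorem inr_mapCoproductIso (X Y : C) :
    inr _ _ ≫ (mapCoproductIso A X Y).hom = A.map (inr X Y) := inr_desc _ _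

/-- A functor between cocartesian monoidal categories that preserves finite colimits is a strong
monoidal functor, with the canonical coherence isomorphisms. -/
instance functorMonoidal : A.Monoidal :=
  Functor.CoreMonoidal.toMonoidal
    { εIso := mapUnitIso A
      μIso := mapCoproductIso A
      μIso_hom_natural_left := fun f X' => by
        apply tensor_hom_ext
        · rw [reassoc_of% inl_whiskerRight, reassoc_of% inl_mapCoproductIso, inl_mapCoproductIso,
            ← A.map_comp, ← A.map_comp, inl_whiskerRight]
        · rw [reassoc_of% inr_whiskerRight, reassoc_of% inr_mapCoproductIso, inr_mapCoproductIso,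
            ← A.map_comp, inr_whiskerRight]
      μIso_hom_natural_right := fun X' f => by
        apply tensor_hom_ext
        · rw [reassoc_of% inl_whiskerLeft, reassoc_of% inl_mapCoproductIso, inl_mapCoproductIso,
            ← A.map_comp, inl_whiskerLeft]
        · rw [reassoc_of% inr_whiskerLeft, reassoc_of% inr_mapCoproductIso, inr_mapCoproductIso,
            ← A.map_comp, ← A.map_comp, inr_whiskerLeft]
      associativity := fun X Y Z => by
        apply tensor_hom_ext
        · apply tensor_hom_ext
          · rw [reassoc_of% inl_whiskerRight, reassoc_of% inl_mapCoproductIso,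
              reassoc_of% inl_mapCoproductIso, reassoc_of% inl_inl_associator,
              reassoc_of% inl_whiskerLeft, inl_mapCoproductIso, ← A.map_comp, ← A.map_comp,
              inl_inl_associator]
          · rw [reassoc_of% inl_whiskerRight, reassoc_of% inr_mapCoproductIso,
              reassoc_of% inl_mapCoproductIso, reassoc_of% inr_inl_associator,
              reassoc_of% inr_whiskerLeft, inr_mapCoproductIso,
              reassoc_of% inl_mapCoproductIso, ← A.map_comp, ← A.map_comp, ← A.map_comp,
              inr_inl_associator]
        · rw [reassoc_of% inr_whiskerRight, reassoc_of% inr_mapCoproductIso,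
            reassoc_of% inr_associator, reassoc_of% inr_whiskerLeft, inr_mapCoproductIso,
            reassoc_of% inr_mapCoproductIso, ← A.map_comp, ← A.map_comp, inr_associator]
      left_unitality := fun X => by
        apply tensor_hom_ext
        · exact unit_hom_ext _ _
        · rw [inr_leftUnitor, reassoc_of% inr_whiskerRight, reassoc_of% inr_mapCoproductIso,
            ← A.map_comp, inr_leftUnitor, A.map_id]
      right_unitality := fun X => by
        apply tensor_hom_ext
        · rw [inl_rightUnitor, reassoc_of% inl_whiskerLeft, reassoc_of% inl_mapCoproductIso,
            ← A.map_comp, inl_rightUnitor, A.map_id]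
        · exact unit_hom_ext _ _ }

end Functor

end

end CocartesianMonoidal

/-- A hypergraph category is a symmetric monoidal category in which every object is equipped with
a special commutative Frobenius monoid structure, compatibly with the monoidal product. -/
class HypergraphCategory (H : Type u₁) [Category.{v₁} H] [MonoidalCategory H]
    [SymmetricCategory H] where
  monObj (X : H) : MonObj X
  comonObj (X : H) : ComonObj X
  mul_comm (X : H) : (β_ X X).hom ≫ MonObj.mul (X := X) = MonObj.mul
  comul_comm (X : H) : ComonObj.comul (X := X) ≫ (β_ X X).hom = ComonObj.comul
  frobenius_left (X : H) :
    ComonObj.comul (X := X) ▷ X ≫ (α_ X X X).hom ≫ X ◁ MonObj.mul (X := X) =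
      MonObj.mul (X := X) ≫ ComonObj.comul (X := X)
  frobenius_right (X : H) :
    X ◁ ComonObj.comul (X := X) ≫ (α_ X X X).inv ≫ MonObj.mul (X := X) ▷ X =
      MonObj.mul (X := X) ≫ ComonObj.comul (X := X)
  special (X : H) : ComonObj.comul (X := X) ≫ MonObj.mul (X := X) = 𝟙 X
  mul_tensor (X Y : H) : MonObj.mul (X := X ⊗ Y) =
    tensorμ X Y X Y ≫ (MonObj.mul (X := X) ⊗ₘ MonObj.mul (X := Y))
  one_tensor (X Y : H) : MonObj.one (X := X ⊗ Y) =
    (λ_ (𝟙_ H)).inv ≫ (MonObj.one (X := X) ⊗ₘ MonObj.one (X := Y))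
  comul_tensor (X Y : H) : ComonObj.comul (X := X ⊗ Y) =
    (ComonObj.comul (X := X) ⊗ₘ ComonObj.comul (X := Y)) ≫ tensorμ X X Y Y
  counit_tensor (X Y : H) : ComonObj.counit (X := X ⊗ Y) =
    (ComonObj.counit (X := X) ⊗ₘ ComonObj.counit (X := Y)) ≫ (λ_ (𝟙_ H)).hom

attribute [reducible, instance] HypergraphCategory.monObj HypergraphCategory.comonObj

/-- A strong symmetric monoidal functor between hypergraph categories is a hypergraph functor if
it carries the chosen Frobenius structure on `X` to the chosen Frobenius structure on `T X`. -/
structure IsHypergraphFunctor {H : Type u₁} [Category.{v₁} H] [MonoidalCategory H]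
    [SymmetricCategory H] [HypergraphCategory H] {K : Type u₂} [Category.{v₂} K]
    [MonoidalCategory K] [SymmetricCategory K] [HypergraphCategory K] (T : H ⥤ K)
    [T.Braided] : Prop where
  map_mul (X : H) : MonObj.mul (X := T.obj X) =
    Functor.LaxMonoidal.μ T X X ≫ T.map (MonObj.mul (X := X))
  map_one (X : H) : MonObj.one (X := T.obj X) =
    Functor.LaxMonoidal.ε T ≫ T.map (MonObj.one (X := X))
  map_comul (X : H) : ComonObj.comul (X := T.obj X) =
    T.map (ComonObj.comul (X := X)) ≫ Functor.OplaxMonoidal.δ T X X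
  map_counit (X : H) : ComonObj.counit (X := T.obj X) =
    T.map (ComonObj.counit (X := X)) ≫ Functor.OplaxMonoidal.η T

/-- A lax monoidal functor is strict monoidal if its coherence maps are identities. -/
structure IsStrictMonoidal {H : Type u₁} [Category.{v₁} H] [MonoidalCategory H] {K : Type u₂}
    [Category.{v₂} K] [MonoidalCategory K] (T : H ⥤ K) [T.LaxMonoidal] : Prop where
  unit : ∃ h : 𝟙_ K = T.obj (𝟙_ H), Functor.LaxMonoidal.ε T = eqToHom h
  tensor (X Y : H) : ∃ h : T.obj X ⊗ T.obj Y = T.obj (X ⊗ Y),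
    Functor.LaxMonoidal.μ T X Y = eqToHom h


open CocartesianMonoidal Functor.LaxMonoidal

section

variable {C : Type u₁} [Category.{v₁} C] {D : Type u₂} [Category.{v₂} D] [MonoidalCategory D]

/-- A decoration of `N` is an element `𝟙_ D ⟶ F N`. -/
abbrev Decoration (F : C ⥤ D) (N : C) : Type v₂ := 𝟙_ D ⟶ F.obj N

/-- An `F`-decorated cospan from `X` to `Y`: a cospan `X ⟶ N ⟵ Y` together with a decoration
of its apex. -/
structure DecoratedCospan (F : C ⥤ D) (X Y : C) where
  /-- the apex -/
  apex : C
  /-- the left leg -/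
  left : X ⟶ apex
  /-- the right leg -/
  right : Y ⟶ apex
  /-- the decoration -/
  decoration : 𝟙_ D ⟶ F.obj apex

namespace Decoration

variable {F : C ⥤ D}

/-- The pushforward of a decoration along the `F`-image of a map. -/
def push {N M : C} (f : N ⟶ M) (s : Decoration F N) : Decoration F M :=
  s ≫ F.map f

theorem push_id {N : C} (s : Decoration F N) : push (𝟙 N) s = s := by
  simp [push]

theorem push_comp {N M P : C} (f : N ⟶ M) (g : M ⟶ P) (s : Decoration F N) :
    push (f ≫ g) s = push g (push f s) := by
  simp [push]

noncomputable section

variable [MonoidalCategory C] [F.LaxMonoidal]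

/-- The product decoration
`𝟙_ D ⟶ 𝟙_ D ⊗ 𝟙_ D ⟶ F N ⊗ F M ⟶ F (N + M)` of decorations of `N` and `M`. -/
def prod {N M : C} (s : Decoration F N) (t : Decoration F M) : Decoration F (N ⊗ M) :=
  (λ_ (𝟙_ D)).inv ≫ (s ⊗ₘ t) ≫ μ F N M

theorem prod_push {N M N' M' : C} (f : N ⟶ N') (g : M ⟶ M')
    (s : Decoration F N) (t : Decoration F M) :
    prod (push f s) (push g t) = push (f ⊗ₘ g) (prod s t) := by
  simp only [prod, push, Category.assoc, ← μ_natural]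
  rw [← MonoidalCategory.tensorHom_comp_tensorHom_assoc]

theorem prod_assoc {N M P : C} (s : Decoration F N) (t : Decoration F M) (u : Decoration F P) :
    push (α_ N M P).hom (prod (prod s t) u) = prod s (prod t u) := by
  have h1 : (prod s t ⊗ₘ u) =
      (λ_ (𝟙_ D)).inv ▷ _ ≫ ((s ⊗ₘ t) ⊗ₘ u) ≫ μ F N M ▷ _ := by
    simp only [prod, ← MonoidalCategory.tensorHom_id,
      MonoidalCategory.tensorHom_comp_tensorHom, Category.comp_id, Category.id_comp]
  have h2 : (s ⊗ₘ prod t u) =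
      _ ◁ (λ_ (𝟙_ D)).inv ≫ (s ⊗ₘ (t ⊗ₘ u)) ≫ _ ◁ μ F M P := by
    simp only [prod, ← MonoidalCategory.id_tensorHom,
      MonoidalCategory.tensorHom_comp_tensorHom, Category.comp_id, Category.id_comp]
  change push _ ((λ_ (𝟙_ D)).inv ≫ (prod s t ⊗ₘ u) ≫ μ F _ _) =
    (λ_ (𝟙_ D)).inv ≫ (s ⊗ₘ prod t u) ≫ μ F _ _
  rw [h1, h2, push]
  simp only [Category.assoc, associativity]
  rw [MonoidalCategory.associator_naturality_assoc]
  congr 1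
  simp only [← Category.assoc]
  congr 3
  rw [MonoidalCategory.leftUnitor_inv_whiskerRight]
  simp

/-- The canonical decoration of the monoidal unit. -/
def unit (F : C ⥤ D) [F.LaxMonoidal] : Decoration F (𝟙_ C) := ε F

theorem prod_unit {N : C} (s : Decoration F N) : push (ρ_ N).hom (prod s (unit F)) = s := by
  have h1 : (s ⊗ₘ ε F) = s ▷ _ ≫ _ ◁ ε F := by
    rw [MonoidalCategory.tensorHom_def]
  rw [push, prod, unit, h1]
  simp only [Category.assoc]
  rw [← right_unitality, MonoidalCategory.unitors_inv_equal]
  simp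

theorem unit_prod {N : C} (s : Decoration F N) : push (λ_ N).hom (prod (unit F) s) = s := by
  have h1 : (ε F ⊗ₘ s) = _ ◁ s ≫ ε F ▷ _ := by
    rw [MonoidalCategory.tensorHom_def']
  rw [push, prod, unit, h1]
  simp only [Category.assoc]
  rw [← left_unitality]
  simp

end

end Decoration

namespace Decoration

noncomputable section

variable [MonoidalCategory C] [SymmetricCategory C] [BraidedCategory D] {F : C ⥤ D} [F.LaxBraided]

theorem prod_comm {N M : C} (s : Decoration F N) (t : Decoration F M) :
    push (β_ N M).hom (prod s t) = prod t s := by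
  rw [push, prod, prod]
  simp only [Category.assoc, Functor.LaxBraided.braided]
  rw [BraidedCategory.braiding_naturality_assoc]
  simp [MonoidalCategory.unitors_inv_equal]

end

end Decoration

namespace Decoration

noncomputable section

variable [MonoidalCategory C] [SymmetricCategory C] [CocartesianMonoidal C]

/-- Decorations of a fixed object form a monoid, with unit the empty decoration
`𝟙_ D ⟶ F ∅ ⟶ F N`. -/
scoped instance instMonoid {F : C ⥤ D} [F.LaxMonoidal] (N : C) : Monoid (Decoration F N) where
  mul s t := push (desc (𝟙 N) (𝟙 N)) (prod s t)
  one := push (fromUnit N) (unit F)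
  mul_assoc s t u := by
    change push _ (prod (push _ (prod s t)) u) = push _ (prod s (push _ (prod t u)))
    conv_lhs => rw [← push_id u]
    conv_rhs => rw [← push_id s]
    rw [prod_push, prod_push, ← prod_assoc]
    simp only [← push_comp]
    congr 1
    simp only [Category.assoc]
    apply tensor_hom_ext
    · apply tensor_hom_ext
      · rw [reassoc_of% inl_tensorHom, inl_desc, reassoc_of% inl_desc,
          reassoc_of% inl_inl_associator, reassoc_of% inl_tensorHom, inl_desc, Category.id_comp]
      · rw [reassoc_of% inl_tensorHom, inl_desc, reassoc_of% inr_desc,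
          reassoc_of% inr_inl_associator, reassoc_of% inr_tensorHom, inr_desc,
          reassoc_of% inl_desc, Category.id_comp]
    · rw [reassoc_of% inr_tensorHom, inr_desc, reassoc_of% inr_associator,
        reassoc_of% inr_tensorHom, inr_desc, reassoc_of% inr_desc, Category.id_comp]
  one_mul s := by
    change push _ (prod (push _ (unit F)) s) = s
    conv_lhs => rw [← push_id s, prod_push, ← push_comp]
    conv_rhs => rw [← unit_prod s]
    congr 1
    apply tensor_hom_ext
    · exact unit_hom_ext _ _
    · rw [reassoc_of% inr_tensorHom, inr_desc, inr_leftUnitor]; simp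
  mul_one s := by
    change push _ (prod s (push _ (unit F))) = s
    conv_lhs => rw [← push_id s, prod_push, ← push_comp]
    conv_rhs => rw [← prod_unit s]
    congr 1
    apply tensor_hom_ext
    · rw [reassoc_of% inl_tensorHom, inl_desc, inl_rightUnitor]; simp
    · exact unit_hom_ext _ _

section

variable {F : C ⥤ D} [F.LaxMonoidal]

theorem mul_def {N : C} (s t : Decoration F N) : s * t = push (desc (𝟙 N) (𝟙 N)) (prod s t) := rfl

theorem one_def (N : C) : (1 : Decoration F N) = push (fromUnit N) (unit F) := rfl

theorem unit_eq_one : unit F = (1 : Decoration F (𝟙_ C)) := by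
  rw [one_def, unit_hom_ext (fromUnit (𝟙_ C)) (𝟙 _), push_id]

theorem push_one {N M : C} (f : N ⟶ M) : push f (1 : Decoration F N) = 1 := by
  rw [one_def, one_def, ← push_comp]
  congr 1
  exact unit_hom_ext _ _

theorem push_desc_prod {N M P : C} (f : N ⟶ P) (g : M ⟶ P) (s : Decoration F N)
    (t : Decoration F M) : push (desc f g) (prod s t) = push f s * push g t := by
  rw [mul_def, prod_push, ← push_comp, tensorHom_desc, Category.comp_id, Category.comp_id]

theorem push_mul {N M : C} (f : N ⟶ M) (s t : Decoration F N) :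
    push f (s * t) = push f s * push f t := by
  rw [← push_desc_prod, mul_def, ← push_comp, desc_comp, Category.id_comp]

theorem prod_eq {N M : C} (s : Decoration F N) (t : Decoration F M) :
    prod s t = push (inl N M) s * push (inr N M) t := by
  rw [← push_desc_prod]
  conv_lhs => rw [← push_id (prod s t)]
  congr 1
  apply tensor_hom_ext
  · rw [inl_desc, Category.comp_id]
  · rw [inr_desc, Category.comp_id]

end

/-- For a lax braided functor, decorations commute. -/
scoped instance instCommMonoid [BraidedCategory D] {F : C ⥤ D} [F.LaxBraided] (N : C) :
    CommMonoid (Decoration F N) where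
  toMonoid := instMonoid N
  mul_comm s t := by
    rw [mul_def, mul_def, ← prod_comm t s, ← push_comp]
    congr 1
    apply tensor_hom_ext
    · rw [reassoc_of% inl_braiding, inr_desc, inl_desc]
    · rw [reassoc_of% inr_braiding, inr_desc, inl_desc]

end

end Decoration

namespace DecoratedCospan

variable {F : C ⥤ D} {X Y : C}

/-- Decorated cospans with the same feet are identified if there is an isomorphism between their
apices that is compatible with the legs and with the decorations. -/
def Isomorphic (c d : DecoratedCospan F X Y) : Prop :=
  ∃ n : c.apex ≅ d.apex, c.left ≫ n.hom = d.left ∧ c.right ≫ n.hom = d.right ∧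
    c.decoration ≫ F.map n.hom = d.decoration

/-- The setoid of isomorphic decorated cospans. -/
def setoid (F : C ⥤ D) (X Y : C) : Setoid (DecoratedCospan F X Y) where
  r := Isomorphic
  iseqv :=
    { refl := fun c => ⟨Iso.refl _, by simp, by simp, by simp⟩
      symm := by
        rintro c d ⟨n, h₁, h₂, h₃⟩
        exact ⟨n.symm, by simp [← h₁], by simp [← h₂], by simp [← h₃, ← F.map_comp]⟩
      trans := by
        rintro c d e ⟨n, h₁, h₂, h₃⟩ ⟨m, k₁, k₂, k₃⟩
        exact ⟨n.trans m, by simp [← k₁, ← h₁], by simp [← k₂, ← h₂], by simp [← k₃, ← h₃]⟩ }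

noncomputable section

variable [MonoidalCategory C] [F.LaxMonoidal]

/-- The monoidal product of decorated cospans: the coproduct of the underlying cospans, with
decoration `𝟙_ D ⟶ 𝟙_ D ⊗ 𝟙_ D ⟶ F N ⊗ F N' ⟶ F (N + N')`. -/
def tensor {X Y X' Y' : C} (c : DecoratedCospan F X Y) (d : DecoratedCospan F X' Y') :
    DecoratedCospan F (X ⊗ X') (Y ⊗ Y') where
  apex := c.apex ⊗ d.apex
  left := c.left ⊗ₘ d.left
  right := c.right ⊗ₘ d.right
  decoration := (λ_ (𝟙_ D)).inv ≫ (c.decoration ⊗ₘ d.decoration) ≫ μ F c.apex d.apex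

theorem tensor_congr {X Y X' Y' : C} {c c' : DecoratedCospan F X Y}
    {d d' : DecoratedCospan F X' Y'} (hc : Isomorphic c c') (hd : Isomorphic d d') :
    Isomorphic (c.tensor d) (c'.tensor d') := by
  obtain ⟨n, h₁, h₂, h₃⟩ := hc
  obtain ⟨m, k₁, k₂, k₃⟩ := hd
  refine ⟨n ⊗ᵢ m, ?_, ?_, ?_⟩
  · simp [tensor, h₁, k₁, MonoidalCategory.tensorHom_comp_tensorHom]
  · simp [tensor, h₂, k₂, MonoidalCategory.tensorHom_comp_tensorHom]
  · exact (Decoration.prod_push n.hom m.hom c.decoration d.decoration).symm.trans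
      (congrArg₂ Decoration.prod h₃ k₃)

variable [SymmetricCategory C] [CocartesianMonoidal C]

/-- The composite of decorated cospans: the composite by pushout of the underlying cospans, with
decoration `𝟙_ D ⟶ 𝟙_ D ⊗ 𝟙_ D ⟶ F N ⊗ F M ⟶ F (N + M) ⟶ F (N +_Y M)`. -/
def comp [HasPushouts C] {X Y Z : C} (c : DecoratedCospan F X Y) (d : DecoratedCospan F Y Z) :
    DecoratedCospan F X Z where
  apex := pushout c.right d.left
  left := c.left ≫ pushout.inl c.right d.left
  right := d.right ≫ pushout.inr c.right d.left
  decoration := (λ_ (𝟙_ D)).inv ≫ (c.decoration ⊗ₘ d.decoration) ≫ μ F c.apex d.apex ≫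
    F.map (desc (pushout.inl c.right d.left) (pushout.inr c.right d.left))

/-- The cospan `X ⟶ N ⟵ Y` with the empty decoration `𝟙_ D ⟶ F ∅ ⟶ F N`. -/
def empty (F : C ⥤ D) [F.LaxMonoidal] {X Y N : C} (i : X ⟶ N) (o : Y ⟶ N) :
    DecoratedCospan F X Y where
  apex := N
  left := i
  right := o
  decoration := ε F ≫ F.map (fromUnit N)

open Decoration

theorem comp_decoration [HasPushouts C] {X Y Z : C} (c : DecoratedCospan F X Y)
    (d : DecoratedCospan F Y Z) :
    (c.comp d).decoration = push (pushout.inl c.right d.left) c.decoration *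
      push (pushout.inr c.right d.left) d.decoration := by
  rw [← push_desc_prod]
  simp [comp, push, Decoration.prod]

theorem empty_decoration {X Y N : C} (i : X ⟶ N) (o : Y ⟶ N) :
    (empty F i o).decoration = (1 : Decoration F N) := rfl

/-- Composition may be computed by any pushout square. -/
theorem comp_isomorphic [HasPushouts C] {X Y Z N M P : C} {i : X ⟶ N} {o : Y ⟶ N}
    {s : Decoration F N} {i' : Y ⟶ M} {o' : Z ⟶ M} {t : Decoration F M} {l : X ⟶ P} {r : Z ⟶ P}
    {u : Decoration F P} {j : N ⟶ P} {k : M ⟶ P} (sq : IsPushout o i' j k)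
    (hl : i ≫ j = l) (hr : o' ≫ k = r) (hd : push j s * push k t = u) :
    Isomorphic (comp ⟨N, i, o, s⟩ ⟨M, i', o', t⟩) ⟨P, l, r, u⟩ := by
  refine ⟨sq.isoPushout.symm, ?_, ?_, ?_⟩
  · simp [comp, hl]
  · simp [comp, hr]
  · rw [← hd, comp_decoration]
    change push _ (_ * _) = _
    rw [push_mul, ← push_comp, ← push_comp]
    simp

theorem comp_congr [HasPushouts C] {X Y Z : C} {c c' : DecoratedCospan F X Y}
    {d d' : DecoratedCospan F Y Z} (hc : Isomorphic c c') (hd : Isomorphic d d') :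
    Isomorphic (c.comp d) (c'.comp d') := by
  obtain ⟨N, i, o, s⟩ := c
  obtain ⟨N', i₂, o₂, s₂⟩ := c'
  obtain ⟨M, i', o', t⟩ := d
  obtain ⟨M', i₂', o₂', t₂⟩ := d'
  obtain ⟨n, h₁, h₂, h₃⟩ := hc
  obtain ⟨m, k₁, k₂, k₃⟩ := hd
  dsimp only at n h₁ h₂ h₃ m k₁ k₂ k₃
  have key := comp_decoration (F := F) ⟨N', i₂, o₂, s₂⟩ ⟨M', i₂', o₂', t₂⟩
  refine comp_isomorphic (j := n.hom ≫ pushout.inl o₂ i₂') (k := m.hom ≫ pushout.inr o₂ i₂')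
    ?_ ?_ ?_ ?_
  · refine IsPushout.of_iso (IsPushout.of_hasPushout o₂ i₂') (Iso.refl _) n.symm m.symm
      (Iso.refl _) ?_ ?_ ?_ ?_
    · simp [← h₂]
    · simp [← k₁]
    · simp
    · simp
  · simp [← h₁]
  · simp [← k₂]
  · refine Eq.trans ?_ key.symm
    rw [push_comp, push_comp, ← h₃, ← k₃]
    rfl

end

end DecoratedCospan

/-- The objects of the decorated cospan category of `F` are the objects of the domain of `F`. -/
structure DecoratedCospanCat (F : C ⥤ D) where
  /-- the underlying object -/
  as : C

namespace DecoratedCospanCat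

noncomputable section

open DecoratedCospan Decoration

variable [MonoidalCategory C] [SymmetricCategory C] [CocartesianMonoidal C] [HasPushouts C]

section Category

variable {F : C ⥤ D} [F.LaxMonoidal]

/-- The morphisms of the decorated cospan category are the isomorphism classes of decorated
cospans, composed by pushout. -/
instance : CategoryStruct (DecoratedCospanCat F) where
  Hom X Y := Quotient (DecoratedCospan.setoid F X.as Y.as)
  id X := Quotient.mk _ (DecoratedCospan.empty F (𝟙 X.as) (𝟙 X.as))
  comp := Quotient.map₂ DecoratedCospan.comp fun _ _ hc _ _ hd => comp_congr hc hd

/-- The morphism represented by a decorated cospan. -/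
def homMk {X Y : DecoratedCospanCat F} (c : DecoratedCospan F X.as Y.as) : X ⟶ Y :=
  Quotient.mk _ c

theorem homMk_surjective {X Y : DecoratedCospanCat F} (f : X ⟶ Y) : ∃ c, homMk c = f :=
  Quotient.exists_rep f

theorem homMk_eq_iff {X Y : DecoratedCospanCat F} (c d : DecoratedCospan F X.as Y.as) :
    (homMk c : X ⟶ Y) = homMk d ↔ Isomorphic c d :=
  Quotient.eq

theorem homMk_comp_homMk {X Y Z : DecoratedCospanCat F} (c : DecoratedCospan F X.as Y.as)
    (d : DecoratedCospan F Y.as Z.as) :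
    (homMk c : X ⟶ Y) ≫ (homMk d : Y ⟶ Z) = homMk (c.comp d) := rfl

theorem homMk_comp_eq {X Y Z : DecoratedCospanCat F} {N M P : C} {i : X.as ⟶ N} {o : Y.as ⟶ N}
    {s : Decoration F N} {i' : Y.as ⟶ M} {o' : Z.as ⟶ M} {t : Decoration F M} {l : X.as ⟶ P}
    {r : Z.as ⟶ P} {u : Decoration F P} {j : N ⟶ P} {k : M ⟶ P} (sq : IsPushout o i' j k)
    (hl : i ≫ j = l) (hr : o' ≫ k = r) (hd : push j s * push k t = u) :
    (homMk ⟨N, i, o, s⟩ : X ⟶ Y) ≫ (homMk ⟨M, i', o', t⟩ : Y ⟶ Z) = homMk ⟨P, l, r, u⟩ :=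
  (homMk_eq_iff _ _).2 (comp_isomorphic sq hl hr hd)

theorem homMk_eq {X Y : DecoratedCospanCat F} {N M : C} {i : X.as ⟶ N} {o : Y.as ⟶ N}
    {s : Decoration F N} {i' : X.as ⟶ M} {o' : Y.as ⟶ M} {t : Decoration F M} (n : N ≅ M)
    (h₁ : i ≫ n.hom = i') (h₂ : o ≫ n.hom = o') (h₃ : push n.hom s = t) :
    (homMk ⟨N, i, o, s⟩ : X ⟶ Y) = homMk ⟨M, i', o', t⟩ :=
  (homMk_eq_iff _ _).2 ⟨n, h₁, h₂, h₃⟩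

theorem id_eq_homMk (X : DecoratedCospanCat F) :
    𝟙 X = homMk ⟨X.as, 𝟙 X.as, 𝟙 X.as, (1 : Decoration F X.as)⟩ := rfl

instance : Category (DecoratedCospanCat F) where
  id_comp := by
    intro X Y f
    obtain ⟨⟨N, i, o, s⟩, rfl⟩ := homMk_surjective f
    refine homMk_comp_eq (j := i) (k := 𝟙 _) (IsPushout.of_horiz_isIso ⟨by simp⟩) ?_ ?_ ?_
    · simp
    · simp
    · exact (congrArg₂ _ (push_one i) (push_id s)).trans (one_mul s)
  comp_id := by
    intro X Y f
    obtain ⟨⟨N, i, o, s⟩, rfl⟩ := homMk_surjective f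
    refine homMk_comp_eq (k := o) (j := 𝟙 _) (IsPushout.of_vert_isIso ⟨by simp⟩) ?_ ?_ ?_
    · simp
    · simp
    · exact (congrArg₂ _ (push_id s) (push_one o)).trans (mul_one s)
  assoc := by
    intro W X Y Z f g h
    obtain ⟨⟨N, i, o, s⟩, rfl⟩ := homMk_surjective f
    obtain ⟨⟨M, i', o', t⟩, rfl⟩ := homMk_surjective g
    obtain ⟨⟨P, i'', o'', u⟩, rfl⟩ := homMk_surjective h
    have sq₁ := IsPushout.of_hasPushout o i'
    have sq₂ := IsPushout.of_hasPushout o' i''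
    have sq₃ := IsPushout.of_hasPushout (pushout.inr o i') (pushout.inl o' i'')
    rw [homMk_comp_eq sq₁ rfl rfl rfl, homMk_comp_eq sq₂ rfl rfl rfl,
      homMk_comp_eq (sq₂.paste_horiz sq₃) rfl rfl rfl,
      homMk_comp_eq (sq₁.paste_vert sq₃) rfl rfl rfl]
    refine homMk_eq (Iso.refl _) (by simp) (by simp) ?_
    rw [Iso.refl_hom, push_id, push_mul, push_mul, ← push_comp, ← push_comp, ← push_comp,
      ← push_comp, sq₃.w, mul_assoc]

/-- The morphism represented by the cospan `X ⟶ N ⟵ Y` with the empty decoration. -/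
def emptyMk {X Y : DecoratedCospanCat F} {N : C} (i : X.as ⟶ N) (o : Y.as ⟶ N) : X ⟶ Y :=
  homMk (DecoratedCospan.empty F i o)

theorem emptyMk_def {X Y : DecoratedCospanCat F} {N : C} (i : X.as ⟶ N) (o : Y.as ⟶ N) :
    (emptyMk i o : X ⟶ Y) = homMk ⟨N, i, o, (1 : Decoration F N)⟩ := rfl

theorem emptyMk_comp_emptyMk {X Y Z : DecoratedCospanCat F} {N M P : C} {i : X.as ⟶ N}
    {o : Y.as ⟶ N} {i' : Y.as ⟶ M} {o' : Z.as ⟶ M} {j : N ⟶ P} {k : M ⟶ P}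
    (sq : IsPushout o i' j k) :
    (emptyMk i o : X ⟶ Y) ≫ (emptyMk i' o' : Y ⟶ Z) = emptyMk (i ≫ j) (o' ≫ k) :=
  homMk_comp_eq sq rfl rfl ((congrArg₂ _ (push_one j) (push_one k)).trans (one_mul _))

/-- A morphism of `C`, as the cospan `X ⟶ Y ⟵ Y` with the empty decoration. -/
def ofHom {X Y : DecoratedCospanCat F} (f : X.as ⟶ Y.as) : X ⟶ Y := emptyMk f (𝟙 Y.as)

/-- The opposite of a morphism of `C`: the cospan `X ⟶ X ⟵ Y` with the empty decoration. -/
def opHom {X Y : DecoratedCospanCat F} (f : Y.as ⟶ X.as) : X ⟶ Y := emptyMk (𝟙 X.as) f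

theorem ofHom_id (X : DecoratedCospanCat F) : ofHom (𝟙 X.as) = 𝟙 X := rfl

theorem opHom_id (X : DecoratedCospanCat F) : opHom (𝟙 X.as) = 𝟙 X := rfl

theorem ofHom_comp_homMk {X Y Z : DecoratedCospanCat F} (f : X.as ⟶ Y.as) {N : C} (i : Y.as ⟶ N)
    (o : Z.as ⟶ N) (s : Decoration F N) :
    ofHom f ≫ (homMk ⟨N, i, o, s⟩ : Y ⟶ Z) = homMk ⟨N, f ≫ i, o, s⟩ :=
  homMk_comp_eq (j := i) (k := 𝟙 _) (IsPushout.of_horiz_isIso ⟨by simp⟩) rfl (by simp)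
    ((congrArg₂ _ (push_one i) (push_id s)).trans (one_mul s))

theorem homMk_comp_opHom {X Y Z : DecoratedCospanCat F} (f : Z.as ⟶ Y.as) {N : C} (i : X.as ⟶ N)
    (o : Y.as ⟶ N) (s : Decoration F N) :
    (homMk ⟨N, i, o, s⟩ : X ⟶ Y) ≫ opHom f = homMk ⟨N, i, f ≫ o, s⟩ :=
  homMk_comp_eq (k := o) (j := 𝟙 _) (IsPushout.of_vert_isIso ⟨by simp⟩) (by simp) rfl
    ((congrArg₂ _ (push_id s) (push_one o)).trans (mul_one s))

theorem ofHom_comp_emptyMk {X Y Z : DecoratedCospanCat F} (f : X.as ⟶ Y.as) {N : C} (i : Y.as ⟶ N)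
    (o : Z.as ⟶ N) : ofHom f ≫ (emptyMk i o : Y ⟶ Z) = emptyMk (f ≫ i) o :=
  ofHom_comp_homMk f i o _

theorem emptyMk_comp_opHom {X Y Z : DecoratedCospanCat F} (f : Z.as ⟶ Y.as) {N : C} (i : X.as ⟶ N)
    (o : Y.as ⟶ N) : (emptyMk i o : X ⟶ Y) ≫ opHom f = emptyMk i (f ≫ o) :=
  homMk_comp_opHom f i o _

theorem ofHom_comp_ofHom {X Y Z : DecoratedCospanCat F} (f : X.as ⟶ Y.as) (g : Y.as ⟶ Z.as) :
    ofHom f ≫ ofHom g = ofHom (X := X) (Y := Z) (f ≫ g) := ofHom_comp_emptyMk _ _ _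

theorem opHom_comp_opHom {X Y Z : DecoratedCospanCat F} (f : Y.as ⟶ X.as) (g : Z.as ⟶ Y.as) :
    opHom f ≫ opHom g = opHom (X := X) (Y := Z) (g ≫ f) := emptyMk_comp_opHom _ _ _

variable (F) in
/-- The embedding of `C` into the decorated cospan category. -/
def embed : C ⥤ DecoratedCospanCat F where
  obj X := ⟨X⟩
  map f := ofHom f
  map_id _ := ofHom_id _
  map_comp _ _ := (ofHom_comp_ofHom _ _).symm

/-- An isomorphism of `C`, as an isomorphism of the decorated cospan category. -/
def ofIso {X Y : DecoratedCospanCat F} (e : X.as ≅ Y.as) : X ≅ Y where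
  hom := ofHom e.hom
  inv := ofHom e.inv
  hom_inv_id := by rw [ofHom_comp_ofHom, e.hom_inv_id, ofHom_id]
  inv_hom_id := by rw [ofHom_comp_ofHom, e.inv_hom_id, ofHom_id]

theorem ofHom_eq_opHom {X Y : DecoratedCospanCat F} (e : X.as ≅ Y.as) :
    (ofHom e.hom : X ⟶ Y) = opHom e.inv :=
  homMk_eq e.symm (by simp) (by simp) (push_one _)

/-- Naturality with respect to isomorphisms of `C`. -/
theorem homMk_comp_ofHom_eq {X Y X' Y' : DecoratedCospanCat F} {N M : C} {i : X.as ⟶ N}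
    {o : Y.as ⟶ N} {s : Decoration F N} {i' : X'.as ⟶ M} {o' : Y'.as ⟶ M} {t : Decoration F M}
    (f : X.as ≅ X'.as) (g : Y.as ≅ Y'.as) (n : N ≅ M) (h₁ : i ≫ n.hom = f.hom ≫ i')
    (h₂ : o ≫ n.hom = g.hom ≫ o') (h₃ : push n.hom s = t) :
    (homMk ⟨N, i, o, s⟩ : X ⟶ Y) ≫ (ofHom g.hom : Y ⟶ Y') =
      (ofHom f.hom : X ⟶ X') ≫ (homMk ⟨M, i', o', t⟩ : X' ⟶ Y') := by
  rw [ofHom_comp_homMk, ofHom_eq_opHom, homMk_comp_opHom]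
  exact homMk_eq n h₁ (by simp [h₂]) h₃

end Category

section Monoidal

variable [BraidedCategory D] {F : C ⥤ D} [F.LaxBraided]

/-- The monoidal product is the coproduct on objects and the coproduct of decorated cospans on
morphisms; the associator and unitors are those of `C`. -/
instance : MonoidalCategoryStruct (DecoratedCospanCat F) where
  tensorObj X Y := ⟨X.as ⊗ Y.as⟩
  tensorUnit := ⟨𝟙_ C⟩
  tensorHom := Quotient.map₂ DecoratedCospan.tensor fun _ _ hc _ _ hd => tensor_congr hc hd
  whiskerLeft X _ _ f :=
    Quotient.map₂ DecoratedCospan.tensor (fun _ _ hc _ _ hd => tensor_congr hc hd) (𝟙 X) f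
  whiskerRight f Y :=
    Quotient.map₂ DecoratedCospan.tensor (fun _ _ hc _ _ hd => tensor_congr hc hd) f (𝟙 Y)
  associator X Y Z := ofIso (α_ X.as Y.as Z.as)
  leftUnitor X := ofIso (λ_ X.as)
  rightUnitor X := ofIso (ρ_ X.as)

theorem homMk_tensorHom_homMk {X Y X' Y' : DecoratedCospanCat F} {N M : C} (i : X.as ⟶ N)
    (o : Y.as ⟶ N) (s : Decoration F N) (i' : X'.as ⟶ M) (o' : Y'.as ⟶ M) (t : Decoration F M) :
    (homMk ⟨N, i, o, s⟩ : X ⟶ Y) ⊗ₘ (homMk ⟨M, i', o', t⟩ : X' ⟶ Y') =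
      homMk ⟨N ⊗ M, i ⊗ₘ i', o ⊗ₘ o', Decoration.prod s t⟩ := rfl

theorem emptyMk_tensorHom_emptyMk {X Y X' Y' : DecoratedCospanCat F} {N M : C} (i : X.as ⟶ N)
    (o : Y.as ⟶ N) (i' : X'.as ⟶ M) (o' : Y'.as ⟶ M) :
    (emptyMk i o : X ⟶ Y) ⊗ₘ (emptyMk i' o' : X' ⟶ Y') = emptyMk (i ⊗ₘ i') (o ⊗ₘ o') := by
  rw [emptyMk_def, emptyMk_def, homMk_tensorHom_homMk, prod_eq, push_one, push_one, one_mul]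
  rfl

theorem ofHom_tensorHom_ofHom {X Y X' Y' : DecoratedCospanCat F} (f : X.as ⟶ Y.as)
    (g : X'.as ⟶ Y'.as) :
    (ofHom f : X ⟶ Y) ⊗ₘ (ofHom g : X' ⟶ Y') = ofHom (X := X ⊗ X') (Y := Y ⊗ Y') (f ⊗ₘ g) := by
  refine (emptyMk_tensorHom_emptyMk _ _ _ _).trans ?_
  rw [MonoidalCategory.id_tensorHom_id]
  rfl

theorem opHom_tensorHom_opHom {X Y X' Y' : DecoratedCospanCat F} (f : Y.as ⟶ X.as)
    (g : Y'.as ⟶ X'.as) :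
    (opHom f : X ⟶ Y) ⊗ₘ (opHom g : X' ⟶ Y') = opHom (X := X ⊗ X') (Y := Y ⊗ Y') (f ⊗ₘ g) := by
  refine (emptyMk_tensorHom_emptyMk _ _ _ _).trans ?_
  rw [MonoidalCategory.id_tensorHom_id]
  rfl

theorem associator_hom (X Y Z : DecoratedCospanCat F) :
    (α_ X Y Z).hom = ofHom (α_ X.as Y.as Z.as).hom := rfl

theorem associator_inv (X Y Z : DecoratedCospanCat F) :
    (α_ X Y Z).inv = ofHom (α_ X.as Y.as Z.as).inv := rfl

theorem leftUnitor_hom (X : DecoratedCospanCat F) : (λ_ X).hom = ofHom (λ_ X.as).hom := rfl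

theorem leftUnitor_inv (X : DecoratedCospanCat F) : (λ_ X).inv = ofHom (λ_ X.as).inv := rfl

theorem rightUnitor_hom (X : DecoratedCospanCat F) : (ρ_ X).hom = ofHom (ρ_ X.as).hom := rfl

theorem rightUnitor_inv (X : DecoratedCospanCat F) : (ρ_ X).inv = ofHom (ρ_ X.as).inv := rfl

instance : MonoidalCategory (DecoratedCospanCat F) :=
  MonoidalCategory.ofTensorHom
    (id_tensorHom_id := fun X Y => by
      rw [← ofHom_id X, ← ofHom_id Y, ofHom_tensorHom_ofHom, MonoidalCategory.id_tensorHom_id]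
      rfl)
    (id_tensorHom := fun _ _ _ _ => rfl)
    (tensorHom_id := fun _ _ => rfl)
    (tensorHom_comp_tensorHom := by
      intro X₁ Y₁ Z₁ X₂ Y₂ Z₂ f₁ f₂ g₁ g₂
      obtain ⟨⟨N₁, i₁, o₁, s₁⟩, rfl⟩ := homMk_surjective f₁
      obtain ⟨⟨N₂, i₂, o₂, s₂⟩, rfl⟩ := homMk_surjective f₂
      obtain ⟨⟨M₁, k₁, p₁, t₁⟩, rfl⟩ := homMk_surjective g₁
      obtain ⟨⟨M₂, k₂, p₂, t₂⟩, rfl⟩ := homMk_surjective g₂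
      have sq₁ := IsPushout.of_hasPushout o₁ k₁
      have sq₂ := IsPushout.of_hasPushout o₂ k₂
      rw [homMk_tensorHom_homMk, homMk_tensorHom_homMk, homMk_comp_eq sq₁ rfl rfl rfl,
        homMk_comp_eq sq₂ rfl rfl rfl, homMk_tensorHom_homMk]
      refine homMk_comp_eq (isPushout_tensor sq₁ sq₂) ?_ ?_ ?_
      · rw [MonoidalCategory.tensorHom_comp_tensorHom]
      · rw [MonoidalCategory.tensorHom_comp_tensorHom]
      · rw [← prod_push, ← prod_push]
        simp only [prod_eq, push_mul]
        exact mul_mul_mul_comm (G := Decoration F _) _ _ _ _)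
    (associator_naturality := by
      intro X₁ X₂ X₃ Y₁ Y₂ Y₃ f₁ f₂ f₃
      obtain ⟨⟨N₁, i₁, o₁, s₁⟩, rfl⟩ := homMk_surjective f₁
      obtain ⟨⟨N₂, i₂, o₂, s₂⟩, rfl⟩ := homMk_surjective f₂
      obtain ⟨⟨N₃, i₃, o₃, s₃⟩, rfl⟩ := homMk_surjective f₃
      exact homMk_comp_ofHom_eq (α_ _ _ _) (α_ _ _ _) (α_ _ _ _)
        (MonoidalCategory.associator_naturality _ _ _)
        (MonoidalCategory.associator_naturality _ _ _) (prod_assoc _ _ _))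
    (leftUnitor_naturality := by
      intro X Y f
      obtain ⟨⟨N, i, o, s⟩, rfl⟩ := homMk_surjective f
      rw [id_eq_homMk, homMk_tensorHom_homMk]
      refine homMk_comp_ofHom_eq (λ_ _) (λ_ _) (λ_ _) ?_ ?_ ?_
      · exact (congrArg (· ≫ _) (MonoidalCategory.id_tensorHom _ _)).trans
          (MonoidalCategory.leftUnitor_naturality _)
      · exact (congrArg (· ≫ _) (MonoidalCategory.id_tensorHom _ _)).trans
          (MonoidalCategory.leftUnitor_naturality _)
      · rw [← unit_eq_one]; exact unit_prod s)
    (rightUnitor_naturality := by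
      intro X Y f
      obtain ⟨⟨N, i, o, s⟩, rfl⟩ := homMk_surjective f
      rw [id_eq_homMk, homMk_tensorHom_homMk]
      refine homMk_comp_ofHom_eq (ρ_ _) (ρ_ _) (ρ_ _) ?_ ?_ ?_
      · exact (congrArg (· ≫ _) (MonoidalCategory.tensorHom_id _ _)).trans
          (MonoidalCategory.rightUnitor_naturality _)
      · exact (congrArg (· ≫ _) (MonoidalCategory.tensorHom_id _ _)).trans
          (MonoidalCategory.rightUnitor_naturality _)
      · rw [← unit_eq_one]; exact prod_unit s)
    (pentagon := fun W X Y Z => by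
      simp only [associator_hom, ← ofHom_id, ofHom_tensorHom_ofHom]
      erw [ofHom_comp_ofHom, ofHom_comp_ofHom, ofHom_comp_ofHom]
      exact congrArg ofHom (by simp only [MonoidalCategory.id_tensorHom,
        MonoidalCategory.tensorHom_id]; exact MonoidalCategory.pentagon W.as X.as Y.as Z.as))
    (triangle := fun X Y => by
      simp only [associator_hom, leftUnitor_hom, rightUnitor_hom, ← ofHom_id,
        ofHom_tensorHom_ofHom]
      erw [ofHom_comp_ofHom]
      exact congrArg ofHom (by simp only [MonoidalCategory.id_tensorHom,
        MonoidalCategory.tensorHom_id]; exact MonoidalCategory.triangle X.as Y.as))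

theorem whiskerLeft_ofHom (X : DecoratedCospanCat F) {Y Z : DecoratedCospanCat F}
    (f : Y.as ⟶ Z.as) : X ◁ (ofHom f : Y ⟶ Z) = ofHom (X := X ⊗ Y) (Y := X ⊗ Z) (X.as ◁ f) := by
  rw [← MonoidalCategory.id_tensorHom, ← MonoidalCategory.id_tensorHom, ← ofHom_id,
    ofHom_tensorHom_ofHom]

theorem ofHom_whiskerRight {Y Z : DecoratedCospanCat F} (f : Y.as ⟶ Z.as)
    (X : DecoratedCospanCat F) :
    (ofHom f : Y ⟶ Z) ▷ X = ofHom (X := Y ⊗ X) (Y := Z ⊗ X) (f ▷ X.as) := by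
  rw [← MonoidalCategory.tensorHom_id, ← MonoidalCategory.tensorHom_id, ← ofHom_id,
    ofHom_tensorHom_ofHom]

theorem whiskerLeft_opHom (X : DecoratedCospanCat F) {Y Z : DecoratedCospanCat F}
    (f : Z.as ⟶ Y.as) : X ◁ (opHom f : Y ⟶ Z) = opHom (X := X ⊗ Y) (Y := X ⊗ Z) (X.as ◁ f) := by
  rw [← MonoidalCategory.id_tensorHom, ← MonoidalCategory.id_tensorHom, ← opHom_id,
    opHom_tensorHom_opHom]

theorem opHom_whiskerRight {Y Z : DecoratedCospanCat F} (f : Z.as ⟶ Y.as)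
    (X : DecoratedCospanCat F) :
    (opHom f : Y ⟶ Z) ▷ X = opHom (X := Y ⊗ X) (Y := Z ⊗ X) (f ▷ X.as) := by
  rw [← MonoidalCategory.tensorHom_id, ← MonoidalCategory.tensorHom_id, ← opHom_id,
    opHom_tensorHom_opHom]

/-- The braiding of the decorated cospan category is that of `C`. -/
instance : SymmetricCategory (DecoratedCospanCat F) where
  braiding X Y := ofIso (β_ X.as Y.as)
  braiding_naturality_right := by
    intro X Y Z f
    obtain ⟨⟨N, i, o, s⟩, rfl⟩ := homMk_surjective f
    rw [← MonoidalCategory.id_tensorHom, ← MonoidalCategory.tensorHom_id, id_eq_homMk,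
      homMk_tensorHom_homMk, homMk_tensorHom_homMk]
    exact homMk_comp_ofHom_eq (β_ _ _) (β_ _ _) (β_ _ _)
      (BraidedCategory.braiding_naturality _ _) (BraidedCategory.braiding_naturality _ _)
      (prod_comm _ _)
  braiding_naturality_left := by
    intro Y Z f X
    obtain ⟨⟨N, i, o, s⟩, rfl⟩ := homMk_surjective f
    rw [← MonoidalCategory.id_tensorHom, ← MonoidalCategory.tensorHom_id, id_eq_homMk,
      homMk_tensorHom_homMk, homMk_tensorHom_homMk]
    exact homMk_comp_ofHom_eq (β_ _ _) (β_ _ _) (β_ _ _)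
      (BraidedCategory.braiding_naturality _ _) (BraidedCategory.braiding_naturality _ _)
      (prod_comm _ _)
  hexagon_forward X Y Z := by
    rw [associator_hom, associator_hom]
    erw [whiskerLeft_ofHom, ofHom_whiskerRight, ofHom_comp_ofHom, ofHom_comp_ofHom,
      ofHom_comp_ofHom, ofHom_comp_ofHom]
    exact congrArg ofHom (BraidedCategory.hexagon_forward X.as Y.as Z.as)
  hexagon_reverse X Y Z := by
    rw [associator_inv, associator_inv]
    erw [whiskerLeft_ofHom, ofHom_whiskerRight, ofHom_comp_ofHom, ofHom_comp_ofHom,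
      ofHom_comp_ofHom, ofHom_comp_ofHom]
    exact congrArg ofHom (BraidedCategory.hexagon_reverse X.as Y.as Z.as)
  symmetry X Y := by
    erw [ofHom_comp_ofHom]
    exact (congrArg ofHom (SymmetricCategory.symmetry X.as Y.as)).trans (ofHom_id (X ⊗ Y))

theorem braiding_hom (X Y : DecoratedCospanCat F) : (β_ X Y).hom = ofHom (β_ X.as Y.as).hom := rfl

theorem ofHom_tensorμ (X Y Z W : DecoratedCospanCat F) :
    tensorμ X Y Z W = ofHom (X := (X ⊗ Y) ⊗ (Z ⊗ W)) (Y := (X ⊗ Z) ⊗ (Y ⊗ W))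
      (tensorμ X.as Y.as Z.as W.as) := by
  rw [tensorμ, tensorμ, associator_hom, associator_inv, associator_hom, associator_inv,
    braiding_hom]
  erw [ofHom_whiskerRight, whiskerLeft_ofHom, whiskerLeft_ofHom, whiskerLeft_ofHom,
    ofHom_comp_ofHom, ofHom_comp_ofHom, ofHom_comp_ofHom, ofHom_comp_ofHom]
  rfl

/-- The monoid structure on `X` given by the copairing `[1, 1] : X + X ⟶ X` and by
`! : ∅ ⟶ X`. -/
instance (X : DecoratedCospanCat F) : MonObj X where
  one := ofHom (fromUnit X.as)
  mul := ofHom (X := X ⊗ X) (codiag X.as)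
  one_mul := by
    erw [ofHom_whiskerRight, ofHom_comp_ofHom]
    exact congrArg ofHom (fromUnit_whiskerRight_codiag X.as)
  mul_one := by
    erw [whiskerLeft_ofHom, ofHom_comp_ofHom]
    exact congrArg ofHom (whiskerLeft_fromUnit_codiag X.as)
  mul_assoc := by
    rw [associator_hom]
    erw [whiskerLeft_ofHom, ofHom_whiskerRight, ofHom_comp_ofHom, ofHom_comp_ofHom,
      ofHom_comp_ofHom]
    exact congrArg ofHom (codiag_assoc X.as)

/-- The comonoid structure on `X` given by the opposites of the cospans of the monoid
structure. -/
instance (X : DecoratedCospanCat F) : ComonObj X where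
  counit := opHom (fromUnit X.as)
  comul := opHom (Y := X ⊗ X) (codiag X.as)
  counit_comul := by
    erw [opHom_whiskerRight, opHom_comp_opHom]
    refine Eq.trans ?_ (ofHom_eq_opHom (X := X) (Y := 𝟙_ _ ⊗ X) (λ_ X.as).symm).symm
    exact congrArg opHom (fromUnit_whiskerRight_codiag X.as)
  comul_counit := by
    erw [whiskerLeft_opHom, opHom_comp_opHom]
    refine Eq.trans ?_ (ofHom_eq_opHom (X := X) (Y := X ⊗ 𝟙_ _) (ρ_ X.as).symm).symm
    exact congrArg opHom (whiskerLeft_fromUnit_codiag X.as)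
  comul_assoc := by
    rw [associator_hom, ofHom_eq_opHom (X := (X ⊗ X) ⊗ X) (Y := X ⊗ (X ⊗ X)) (α_ _ _ _)]
    erw [whiskerLeft_opHom, opHom_whiskerRight, opHom_comp_opHom, opHom_comp_opHom,
      opHom_comp_opHom]
    refine congrArg opHom ?_
    rw [Category.assoc, codiag_assoc, Iso.inv_hom_id_assoc]

theorem mul_eq (X : DecoratedCospanCat F) :
    MonObj.mul (X := X) = ofHom (X := X ⊗ X) (codiag X.as) := rfl

theorem one_eq (X : DecoratedCospanCat F) :
    MonObj.one (X := X) = ofHom (X := 𝟙_ _) (fromUnit X.as) := rfl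

theorem comul_eq (X : DecoratedCospanCat F) :
    ComonObj.comul (X := X) = opHom (Y := X ⊗ X) (codiag X.as) := rfl

theorem counit_eq (X : DecoratedCospanCat F) :
    ComonObj.counit (X := X) = opHom (Y := 𝟙_ _) (fromUnit X.as) := rfl

theorem opHom_comp_ofHom {X Y Z : DecoratedCospanCat F} {P : C} {f : Y.as ⟶ X.as}
    {g : Y.as ⟶ Z.as} {j : X.as ⟶ P} {k : Z.as ⟶ P} (sq : IsPushout f g j k) :
    opHom f ≫ ofHom g = (emptyMk j k : X ⟶ Z) := by
  refine (emptyMk_comp_emptyMk sq).trans ?_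
  rw [Category.id_comp, Category.id_comp]

theorem ofHom_comp_opHom {X Y Z : DecoratedCospanCat F} (f : X.as ⟶ Y.as) (g : Z.as ⟶ Y.as) :
    ofHom f ≫ opHom g = (emptyMk f g : X ⟶ Z) := by
  refine (ofHom_comp_emptyMk f (𝟙 _) g).trans ?_
  rw [Category.comp_id]

/-- The hypergraph structure of the decorated cospan category. -/
instance : HypergraphCategory (DecoratedCospanCat F) where
  monObj X := inferInstance
  comonObj X := inferInstance
  mul_comm X := by
    rw [braiding_hom, mul_eq]
    erw [ofHom_comp_ofHom]
    exact congrArg ofHom (braiding_codiag X.as)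
  comul_comm X := by
    rw [braiding_hom, comul_eq, ofHom_eq_opHom (X := X ⊗ X) (Y := X ⊗ X) (β_ _ _)]
    erw [opHom_comp_opHom]
    refine congrArg opHom ?_
    rw [Iso.inv_comp_eq, braiding_codiag]
  frobenius_left X := by
    rw [associator_hom, mul_eq, comul_eq]
    erw [whiskerLeft_ofHom, opHom_whiskerRight, ofHom_comp_ofHom, ofHom_comp_opHom]
    exact opHom_comp_ofHom (X := X ⊗ X) (Y := (X ⊗ X) ⊗ X) (Z := X ⊗ X)
      (codiag_frobenius_left X.as)
  frobenius_right X := by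
    rw [associator_inv, mul_eq, comul_eq]
    erw [whiskerLeft_opHom, ofHom_whiskerRight, ofHom_comp_ofHom, ofHom_comp_opHom]
    exact opHom_comp_ofHom (X := X ⊗ X) (Y := X ⊗ (X ⊗ X)) (Z := X ⊗ X)
      (codiag_frobenius_right X.as)
  special X := opHom_comp_ofHom (Y := X ⊗ X) (codiag_special X.as)
  mul_tensor X Y := by
    rw [mul_eq, mul_eq, mul_eq, ofHom_tensorμ, ofHom_tensorHom_ofHom]
    erw [ofHom_comp_ofHom]
    exact congrArg ofHom (tensorμ_codiag X.as Y.as).symm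
  one_tensor X Y := by
    rw [one_eq, one_eq, one_eq, ofHom_tensorHom_ofHom, leftUnitor_inv]
    erw [ofHom_comp_ofHom]
    exact congrArg ofHom (fromUnit_tensor X.as Y.as).symm
  comul_tensor X Y := by
    rw [comul_eq, comul_eq, comul_eq, ofHom_tensorμ, opHom_tensorHom_opHom]
    have h := ofHom_eq_opHom (F := F) (X := (X ⊗ X) ⊗ (Y ⊗ Y)) (Y := (X ⊗ Y) ⊗ (X ⊗ Y))
      ⟨tensorμ X.as X.as Y.as Y.as, tensorδ X.as X.as Y.as Y.as, tensorμ_tensorδ _ _ _ _,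
        tensorδ_tensorμ _ _ _ _⟩
    refine Eq.trans ?_ (congrArg (_ ≫ ·) h).symm
    refine Eq.trans ?_ (opHom_comp_opHom _ _).symm
    exact congrArg opHom (tensorδ_codiag X.as Y.as).symm
  counit_tensor X Y := by
    rw [counit_eq, counit_eq, counit_eq, opHom_tensorHom_opHom]
    have h := ofHom_eq_opHom (F := F) (X := 𝟙_ _ ⊗ 𝟙_ _) (Y := 𝟙_ _) (λ_ (𝟙_ C))
    refine Eq.trans ?_ (congrArg (_ ≫ ·) h).symm
    refine Eq.trans ?_ (opHom_comp_opHom _ _).symm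
    exact congrArg opHom (fromUnit_tensor X.as Y.as).symm

end Monoidal

end

end DecoratedCospanCat

end

noncomputable section

variable {C : Type u₁} [Category.{v₁} C] {D : Type u₂} [Category.{v₂} D] [MonoidalCategory D]
  {C' : Type u₃} [Category.{v₃} C'] {D' : Type u₄} [Category.{v₄} D'] [MonoidalCategory D']
  {F : C ⥤ D} {G : C' ⥤ D'}

/-- The `A`-image of a decorated cospan, with decoration
`𝟙_ D' ⟶ B (𝟙_ D) ⟶ B (F N) ⟶ G (A N)`. -/
def DecoratedCospan.image (A : C ⥤ C') (B : D ⥤ D') [B.LaxMonoidal] (θ : F ⋙ B ⟶ A ⋙ G) {X Y : C}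
    (c : DecoratedCospan F X Y) : DecoratedCospan G (A.obj X) (A.obj Y) where
  apex := A.obj c.apex
  left := A.map c.left
  right := A.map c.right
  decoration := ε B ≫ B.map c.decoration ≫ θ.app c.apex

theorem DecoratedCospan.image_congr (A : C ⥤ C') (B : D ⥤ D') [B.LaxMonoidal]
    (θ : F ⋙ B ⟶ A ⋙ G) {X Y : C} {c d : DecoratedCospan F X Y} (h : Isomorphic c d) :
    Isomorphic (c.image A B θ) (d.image A B θ) := by
  obtain ⟨n, h₁, h₂, h₃⟩ := h
  refine ⟨A.mapIso n, ?_, ?_, ?_⟩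
  · simp [image, ← h₁]
  · simp [image, ← h₂]
  · have := θ.naturality n.hom
    simp only [Functor.comp_map] at this
    simp [image, ← h₃, this]

/-- The map induced by `DecoratedCospan.image` on isomorphism classes of decorated cospans. -/
def DecoratedCospanCat.mapHom [MonoidalCategory C] [SymmetricCategory C] [CocartesianMonoidal C]
    [HasPushouts C] [F.LaxMonoidal] [MonoidalCategory C'] [SymmetricCategory C']
    [CocartesianMonoidal C'] [HasPushouts C'] [G.LaxMonoidal]
    (A : C ⥤ C') (B : D ⥤ D') [B.LaxMonoidal] (θ : F ⋙ B ⟶ A ⋙ G) {X Y : DecoratedCospanCat F}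
    (f : X ⟶ Y) : (⟨A.obj X.as⟩ : DecoratedCospanCat G) ⟶ ⟨A.obj Y.as⟩ :=
  Quotient.map (DecoratedCospan.image A B θ) (fun _ _ h => DecoratedCospan.image_congr A B θ h) f

end

/-! The elements `𝟙_ D ⟶ F.obj N` form a monoid: two of them are multiplied by pushing their product
decoration forward along the codiagonal of `N`, and the empty decoration is the unit. In these terms
a composite of decorated cospans is decorated by the product of the two decorations, each pushed
forward to the pushout. Functoriality of `T` on decorations therefore needs only that `s ↦ ε B ≫
B.map s ≫ θ.app N` is natural in `N` and is a monoid homomorphism. Naturality is that of `θ`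
(`image_push`). The unit comes from the unit axiom of `θ` (`image_one`). The product comes from the
tensor axiom of `θ` and the lax structure of `B` (`image_prod`), combined with the fact that the
canonical isomorphism `A N + A N ≅ A (N + N)` carries the codiagonal to the image of the codiagonal
(`image_mul`). On the underlying cospans, `A` preserves pushouts.

Since empty decorations go to empty decorations, `T` restricts to `A` on maps of `C` and on their
opposite cospans. The associators, unitors, braidings, Frobenius structure maps and coherence maps
are all of these two kinds, so nearly every remaining axiom is an equation in `C'` about coproducts,
and `B` and `θ` play no part in it. The exception is naturality of the coherence maps with respect
to arbitrary decorated cospans, and that is `image_prod` again (`mapHom_tensorHom_comp`).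

Strictness transfers both ways because the embedding `C' ⥤ DecoratedCospanCat G` is faithful and
respects equality of objects (`exists_ofHom_eq_eqToHom_iff`). -/

namespace CocartesianMonoidal

/-! ### Canonical coproduct comparison maps and the image of the codiagonal -/

section

variable {C : Type u₁} [Category.{v₁} C] [MonoidalCategory C] [SymmetricCategory C]
  [CocartesianMonoidal C] {C' : Type u₂} [Category.{v₂} C'] [MonoidalCategory C']
  [SymmetricCategory C'] [CocartesianMonoidal C'] (A : C ⥤ C') [PreservesFiniteColimits A]

theorem inl_μ (X Y : C) : inl _ _ ≫ μ A X Y = A.map (inl X Y) := inl_mapCoproductIso A X Y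

theorem inr_μ (X Y : C) : inr _ _ ≫ μ A X Y = A.map (inr X Y) := inr_mapCoproductIso A X Y

/-- Both sides restrict to the identity along either inclusion. This serves twice: for multiplying
decorations, and for the Frobenius multiplication and comultiplication. -/
theorem μ_comp_map_codiag (X : C) : μ A X X ≫ A.map (codiag X) = codiag (A.obj X) := by
  apply tensor_hom_ext
  · rw [reassoc_of% inl_μ, ← A.map_comp, inl_codiag, inl_codiag, A.map_id]
  · rw [reassoc_of% inr_μ, ← A.map_comp, inr_codiag, inr_codiag, A.map_id]

theorem μ_comp_map_braiding (X Y : C) :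
    μ A X Y ≫ A.map (β_ X Y).hom = (β_ (A.obj X) (A.obj Y)).hom ≫ μ A Y X := by
  apply tensor_hom_ext
  · rw [reassoc_of% inl_μ, ← A.map_comp, inl_braiding, reassoc_of% inl_braiding, inr_μ]
  · rw [reassoc_of% inr_μ, ← A.map_comp, inr_braiding, reassoc_of% inr_braiding, inl_μ]

theorem ε_comp_map_fromUnit (X : C) : ε A ≫ A.map (fromUnit X) = fromUnit (A.obj X) :=
  unit_hom_ext _ _

end

end CocartesianMonoidal

/-! ### Images of decorations: a natural homomorphism of monoids -/

section

variable {C : Type u₁} [Category.{v₁} C] {C' : Type u₂} [Category.{v₂} C']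
  {D : Type u₃} [Category.{v₃} D] [MonoidalCategory D]
  {D' : Type u₄} [Category.{v₄} D'] [MonoidalCategory D']
  {F : C ⥤ D} {G : C' ⥤ D'} (A : C ⥤ C') (B : D ⥤ D') [B.LaxMonoidal] (θ : F ⋙ B ⟶ A ⋙ G)

namespace Decoration

/-- The image of a decoration, `𝟙_ D' ⟶ B (𝟙_ D) ⟶ B (F N) ⟶ G (A N)`. -/
def image {N : C} (s : Decoration F N) : Decoration G (A.obj N) :=
  ε B ≫ B.map s ≫ θ.app N

theorem image_push {N M : C} (f : N ⟶ M) (s : Decoration F N) :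
    image A B θ (push f s) = push (A.map f) (image A B θ s) := by
  have h := θ.naturality f
  simp only [Functor.comp_map] at h
  simp only [image, push, Functor.map_comp, Category.assoc, h]

variable [MonoidalCategory C] [SymmetricCategory C] [CocartesianMonoidal C]
  [MonoidalCategory C'] [SymmetricCategory C'] [CocartesianMonoidal C']
  [F.LaxMonoidal] [G.LaxMonoidal] [PreservesFiniteColimits A] [NatTrans.IsMonoidal θ]

/-- This is the unit axiom of `θ`, once the unit maps of the composites `F ⋙ B` and `A ⋙ G` are
expanded. -/
theorem image_unit : image A B θ (unit F) = push (ε A) (unit G) := by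
  have h := NatTrans.IsMonoidal.unit (τ := θ)
  simp only [Functor.LaxMonoidal.comp_ε, Category.assoc] at h
  exact h

/-- The empty decoration is pushed forward from the initial object, and maps out of an initial
object agree. This is what makes `T` act as `A` on undecorated cospans. -/
theorem image_one (N : C) : image A B θ (1 : Decoration F N) = 1 := by
  rw [one_def, one_def, image_push, image_unit, ← push_comp, ε_comp_map_fromUnit]

theorem image_prod {N M : C} (s : Decoration F N) (t : Decoration F M) :
    image A B θ (prod s t) = push (μ A N M) (prod (image A B θ s) (image A B θ t)) := by
  have h := NatTrans.IsMonoidal.tensor (τ := θ) N M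
  simp only [Functor.LaxMonoidal.comp_μ, Category.assoc] at h
  simp only [image, prod, push, Functor.map_comp, Category.assoc]
  -- The tensor product of the two images splits into layers for `ε B`, for the decorations and for
  -- `θ`. The tensor axiom moves `θ` past the multiplication maps, and naturality of `μ B` moves the
  -- decorations past it. Only the two ways of reaching `B (𝟙_ D ⊗ 𝟙_ D)` remain to be compared.
  rw [← MonoidalCategory.tensorHom_comp_tensorHom_assoc,
    ← MonoidalCategory.tensorHom_comp_tensorHom_assoc, ← h, μ_natural_assoc]
  -- This is left unitality of `B` at the unit object, with the invertible `B.map (λ_ (𝟙_ D)).hom`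
  -- cancelled.
  have h₂ : ε B ≫ B.map (λ_ (𝟙_ D)).inv =
      (λ_ (𝟙_ D')).inv ≫ (ε B ⊗ₘ ε B) ≫ μ B (𝟙_ D) (𝟙_ D) := by
    rw [MonoidalCategory.tensorHom_def', Category.assoc, ← cancel_mono (B.map (λ_ (𝟙_ D)).hom)]
    simp only [Category.assoc, ← B.map_comp, Iso.inv_hom_id, B.map_id, Category.comp_id,
      ← left_unitality]
    simp
  rw [reassoc_of% h₂]

/-- A product is a product decoration pushed along the codiagonal, so `image_prod` leaves a
pushforward along `μ A N N` followed by the image of the codiagonal, which is the codiagonal of `A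
N`. -/
theorem image_mul {N : C} (s t : Decoration F N) :
    image A B θ (s * t) = image A B θ s * image A B θ t := by
  rw [mul_def, mul_def, image_push, image_prod, ← push_comp]
  exact congrArg (push · _) (μ_comp_map_codiag A N)

end Decoration

/-! ### Functoriality on decorated cospans -/

namespace DecoratedCospanCat

open Decoration

variable [MonoidalCategory C] [SymmetricCategory C] [CocartesianMonoidal C]
  [MonoidalCategory C'] [SymmetricCategory C'] [CocartesianMonoidal C']
  [HasFiniteColimits C] [HasFiniteColimits C']

section

variable [F.LaxMonoidal] [G.LaxMonoidal]

theorem mapHom_homMk {X Y : DecoratedCospanCat F} {N : C} (i : X.as ⟶ N) (o : Y.as ⟶ N)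
    (s : Decoration F N) :
    mapHom A B θ (homMk ⟨N, i, o, s⟩ : X ⟶ Y) =
      homMk ⟨A.obj N, A.map i, A.map o, image A B θ s⟩ := rfl

/-- Both right legs are identities, so compatibility with them forces the isomorphism of apices to
be the identity; the left legs then agree. -/
theorem ofHom_injective {X Y : DecoratedCospanCat F} {f g : X.as ⟶ Y.as}
    (h : (ofHom f : X ⟶ Y) = ofHom g) : f = g := by
  obtain ⟨n, h₁, h₂, -⟩ := (homMk_eq_iff _ _).1 h
  exact (Category.comp_id f).symm.trans
    ((congrArg (f ≫ ·) (h₂.symm.trans (Category.id_comp n.hom))).trans h₁)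

theorem ofHom_eqToHom {X Y : DecoratedCospanCat F} (h : X.as = Y.as) (h' : X = Y) :
    (ofHom (eqToHom h) : X ⟶ Y) = eqToHom h' := by
  subst h'
  exact ofHom_id X

/-- Strictness asks for an equality of objects together with an identification of the coherence map.
Objects here are merely wrapped objects of the base category and `ofHom` is injective, so the
condition can be tested there. -/
theorem exists_ofHom_eq_eqToHom_iff {X Y : DecoratedCospanCat F} (f : X.as ⟶ Y.as) :
    (∃ h : X = Y, (ofHom f : X ⟶ Y) = eqToHom h) ↔ ∃ h : X.as = Y.as, f = eqToHom h := by
  constructor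
  · rintro ⟨h, hf⟩
    have h' : X.as = Y.as := congrArg as h
    exact ⟨h', ofHom_injective (hf.trans (ofHom_eqToHom h' h).symm)⟩
  · rintro ⟨h, rfl⟩
    have h' : X = Y := by
      cases X; cases Y; cases h; rfl
    exact ⟨h', ofHom_eqToHom h h'⟩

variable [PreservesFiniteColimits A] [NatTrans.IsMonoidal θ]

theorem mapHom_emptyMk {X Y : DecoratedCospanCat F} {N : C} (i : X.as ⟶ N) (o : Y.as ⟶ N) :
    mapHom A B θ (emptyMk i o : X ⟶ Y) = emptyMk (A.map i) (A.map o) := by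
  rw [emptyMk_def, mapHom_homMk, image_one]
  rfl

theorem mapHom_ofHom {X Y : DecoratedCospanCat F} (f : X.as ⟶ Y.as) :
    mapHom A B θ (ofHom f : X ⟶ Y) = ofHom (A.map f) := by
  refine (mapHom_emptyMk A B θ f (𝟙 Y.as)).trans ?_
  rw [A.map_id]
  rfl

theorem mapHom_opHom {X Y : DecoratedCospanCat F} (f : Y.as ⟶ X.as) :
    mapHom A B θ (opHom f : X ⟶ Y) = opHom (A.map f) := by
  refine (mapHom_emptyMk A B θ (𝟙 X.as) f).trans ?_
  rw [A.map_id]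
  rfl

theorem mapHom_id (X : DecoratedCospanCat F) : mapHom A B θ (𝟙 X) = 𝟙 _ := by
  rw [← ofHom_id, mapHom_ofHom, A.map_id]
  exact ofHom_id _

theorem mapHom_comp {X Y Z : DecoratedCospanCat F} (f : X ⟶ Y) (g : Y ⟶ Z) :
    mapHom A B θ (f ≫ g) = mapHom A B θ f ≫ mapHom A B θ g := by
  obtain ⟨⟨N, i, o, s⟩, rfl⟩ := homMk_surjective f
  obtain ⟨⟨M, i', o', t⟩, rfl⟩ := homMk_surjective g
  have sq := IsPushout.of_hasPushout o i'
  rw [homMk_comp_eq sq rfl rfl rfl, mapHom_homMk, mapHom_homMk, mapHom_homMk]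
  -- Any pushout square computes a composite, so the `A`-image of the chosen square can be used
  -- directly in place of the chosen pushout in `C'`.
  refine (homMk_comp_eq (sq.map A) (A.map_comp _ _).symm (A.map_comp _ _).symm ?_).symm
  rw [image_mul, image_push, image_push]

/-- The functor `X ↦ A X` between decorated cospan categories, acting on morphisms by
`DecoratedCospan.image`. -/
def mapFunctor : DecoratedCospanCat F ⥤ DecoratedCospanCat G where
  obj X := ⟨A.obj X.as⟩
  map f := mapHom A B θ f
  map_id := mapHom_id A B θ
  map_comp := mapHom_comp A B θ

end

/-! ### Monoidal, braided and hypergraph structure of the functor -/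

noncomputable section

variable [BraidedCategory D] [BraidedCategory D'] [F.LaxBraided] [G.LaxBraided]
  [PreservesFiniteColimits A] [NatTrans.IsMonoidal θ]

theorem mapFunctor_map_ofHom {X Y : DecoratedCospanCat F} (f : X.as ⟶ Y.as) :
    (mapFunctor A B θ).map (ofHom f : X ⟶ Y) =
      ofHom (X := (mapFunctor A B θ).obj X) (Y := (mapFunctor A B θ).obj Y) (A.map f) :=
  mapHom_ofHom A B θ f

/-- The coherence maps of `A` are natural with respect to decorated cospans. -/
theorem mapHom_tensorHom_comp {X Y X' Y' : DecoratedCospanCat F} (f : X ⟶ Y) (g : X' ⟶ Y') :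
    (mapHom A B θ f ⊗ₘ mapHom A B θ g) ≫
        ofHom (X := ⟨A.obj Y.as⟩ ⊗ ⟨A.obj Y'.as⟩) (Y := ⟨A.obj (Y ⊗ Y').as⟩) (μ A Y.as Y'.as) =
      ofHom (X := ⟨A.obj X.as⟩ ⊗ ⟨A.obj X'.as⟩) (Y := ⟨A.obj (X ⊗ X').as⟩) (μ A X.as X'.as) ≫
        mapHom A B θ (f ⊗ₘ g) := by
  obtain ⟨⟨N, i, o, s⟩, rfl⟩ := homMk_surjective f
  obtain ⟨⟨M, i', o', t⟩, rfl⟩ := homMk_surjective g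
  -- The isomorphism of apices is the coherence map at `N` and `M`. It respects the legs by
  -- naturality of `μ A`, and the decorations by `image_prod`.
  exact homMk_comp_ofHom_eq (Functor.Monoidal.μIso A X.as X'.as)
    (Functor.Monoidal.μIso A Y.as Y'.as) (Functor.Monoidal.μIso A N M) (μ_natural A i i')
    (μ_natural A o o') (image_prod A B θ s t).symm

/-- The monoidal structure of `mapFunctor`, with the coherence isomorphisms of `A`. -/
def mapFunctorCoreMonoidal : (mapFunctor A B θ).CoreMonoidal where
  εIso := ofIso (Functor.Monoidal.εIso A)
  μIso X Y := ofIso (Functor.Monoidal.μIso A X.as Y.as)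
  μIso_hom_natural_left f Z := by
    -- Writing the identity of the image of `Z` as the image of an identity turns one-variable
    -- naturality into a case of the two-variable statement.
    rw [← MonoidalCategory.tensorHom_id, ← MonoidalCategory.tensorHom_id,
      ← (mapFunctor A B θ).map_id]
    exact mapHom_tensorHom_comp A B θ f (𝟙 Z)
  μIso_hom_natural_right Z f := by
    rw [← MonoidalCategory.id_tensorHom, ← MonoidalCategory.id_tensorHom,
      ← (mapFunctor A B θ).map_id]
    exact mapHom_tensorHom_comp A B θ (𝟙 Z) f
  associativity X Y Z := by
    rw [associator_hom, associator_hom]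
    -- Every map in this axiom is undecorated, so each side collapses to `ofHom` of one map of `C'`
    -- and the axiom for `A` finishes. The unit axioms go the same way.
    erw [mapFunctor_map_ofHom, ofHom_whiskerRight, whiskerLeft_ofHom, ofHom_comp_ofHom,
      ofHom_comp_ofHom, ofHom_comp_ofHom, ofHom_comp_ofHom]
    exact congrArg ofHom (associativity A X.as Y.as Z.as)
  left_unitality X := by
    rw [leftUnitor_hom, leftUnitor_hom]
    erw [mapFunctor_map_ofHom, ofHom_whiskerRight, ofHom_comp_ofHom, ofHom_comp_ofHom]
    exact congrArg ofHom (left_unitality A X.as)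
  right_unitality X := by
    rw [rightUnitor_hom, rightUnitor_hom]
    erw [mapFunctor_map_ofHom, whiskerLeft_ofHom, ofHom_comp_ofHom, ofHom_comp_ofHom]
    exact congrArg ofHom (right_unitality A X.as)

instance : (mapFunctor A B θ).Monoidal := (mapFunctorCoreMonoidal A B θ).toMonoidal

theorem mapFunctor_ε : ε (mapFunctor A B θ) = (embed G).map (ε A) := rfl

theorem mapFunctor_μ (X Y : DecoratedCospanCat F) :
    μ (mapFunctor A B θ) X Y = (embed G).map (μ A X.as Y.as) := rfl

/-- The oplax maps are the inverses of the coherence isomorphisms, and `ofIso` inverts an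
isomorphism by inverting it in the base category. -/
theorem mapFunctor_η :
    Functor.OplaxMonoidal.η (mapFunctor A B θ) =
      (embed G).map (Functor.OplaxMonoidal.η A) := rfl

theorem mapFunctor_δ (X Y : DecoratedCospanCat F) :
    Functor.OplaxMonoidal.δ (mapFunctor A B θ) X Y =
      (embed G).map (Functor.OplaxMonoidal.δ A X.as Y.as) := rfl

/-- The braidings on both sides come from the coproducts, so the compatibility is that of `A` with
swapping summands; no compatibility of `B` with braidings enters. -/
instance mapFunctorBraided : (mapFunctor A B θ).Braided where
  braided X Y := by
    rw [mapFunctor_μ, mapFunctor_μ, braiding_hom, braiding_hom]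
    erw [mapFunctor_map_ofHom, ofHom_comp_ofHom, ofHom_comp_ofHom]
    exact congrArg ofHom (μ_comp_map_braiding A X.as Y.as)

/-- The monoid half rests on preservation of codiagonals and on initiality of the unit. The comonoid
half is the same pair of equations read through opposite cospans. -/
theorem isHypergraphFunctor_mapFunctor : IsHypergraphFunctor (mapFunctor A B θ) where
  map_mul X := by
    rw [mapFunctor_μ, mul_eq, mul_eq]
    erw [mapFunctor_map_ofHom, ofHom_comp_ofHom]
    exact congrArg ofHom (μ_comp_map_codiag A X.as).symm
  map_one X := by
    rw [mapFunctor_ε, one_eq, one_eq]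
    erw [mapFunctor_map_ofHom, ofHom_comp_ofHom]
    exact congrArg ofHom (ε_comp_map_fromUnit A X.as).symm
  map_comul X := by
    rw [mapFunctor_δ, comul_eq, comul_eq]
    -- An isomorphism equals the opposite cospan of its inverse. Hence `δ` becomes `opHom` of `μ A
    -- X.as X.as`, and it composes with the opposite of the image of the codiagonal entirely within
    -- opposite cospans. The counit is handled likewise with `ε A`.
    have h := ofHom_eq_opHom (F := G) (X := (mapFunctor A B θ).obj (X ⊗ X))
      (Y := (mapFunctor A B θ).obj X ⊗ (mapFunctor A B θ).obj X)
      (Functor.Monoidal.μIso A X.as X.as).symm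
    refine Eq.trans ?_ (congrArg₂ (· ≫ ·) (mapHom_opHom A B θ (codiag X.as)) h).symm
    refine Eq.trans ?_ (opHom_comp_opHom _ _).symm
    exact congrArg opHom (μ_comp_map_codiag A X.as).symm
  map_counit X := by
    rw [mapFunctor_η, counit_eq, counit_eq]
    have h := ofHom_eq_opHom (F := G) (X := (mapFunctor A B θ).obj (𝟙_ _)) (Y := 𝟙_ _)
      (Functor.Monoidal.εIso A).symm
    refine Eq.trans ?_ (congrArg₂ (· ≫ ·) (mapHom_opHom A B θ (fromUnit X.as)) h).symm
    refine Eq.trans ?_ (opHom_comp_opHom _ _).symm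
    exact congrArg opHom (ε_comp_map_fromUnit A X.as).symm

/-- The coherence maps of the functor are by definition `ofHom` of those of `A`, so each condition
is tested separately in `C'`. -/
theorem isStrictMonoidal_mapFunctor_iff :
    IsStrictMonoidal (mapFunctor A B θ) ↔ IsStrictMonoidal A := by
  constructor
  · intro h
    exact ⟨(exists_ofHom_eq_eqToHom_iff _).1 h.unit,
      fun X Y => (exists_ofHom_eq_eqToHom_iff _).1 (h.tensor ⟨X⟩ ⟨Y⟩)⟩
  · intro h
    exact ⟨(exists_ofHom_eq_eqToHom_iff _).2 h.unit,
      fun X Y => (exists_ofHom_eq_eqToHom_iff _).2 (h.tensor X.as Y.as)⟩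

end

end DecoratedCospanCat

end

theorem theorem4p1
    {C : Type u₁} [Category.{v₁} C] [HasFiniteColimits C] [MonoidalCategory C]
    [SymmetricCategory C] [CocartesianMonoidal C]
    {C' : Type u₂} [Category.{v₂} C'] [HasFiniteColimits C'] [MonoidalCategory C']
    [SymmetricCategory C'] [CocartesianMonoidal C']
    {D : Type u₃} [Category.{v₃} D] [MonoidalCategory D] [BraidedCategory D]
    {D' : Type u₄} [Category.{v₄} D'] [MonoidalCategory D'] [BraidedCategory D']
    (F : C ⥤ D) [F.LaxBraided] (G : C' ⥤ D') [G.LaxBraided]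
    (A : C ⥤ C') [PreservesFiniteColimits A] (B : D ⥤ D') [B.LaxMonoidal]
    (θ : F ⋙ B ⟶ A ⋙ G) [NatTrans.IsMonoidal θ] :
    ∃ (map_id : ∀ X : DecoratedCospanCat F, DecoratedCospanCat.mapHom A B θ (𝟙 X) = 𝟙 _)
      (map_comp : ∀ {X Y Z : DecoratedCospanCat F} (f : X ⟶ Y) (g : Y ⟶ Z),
        DecoratedCospanCat.mapHom A B θ (f ≫ g) =
          DecoratedCospanCat.mapHom A B θ f ≫ DecoratedCospanCat.mapHom A B θ g),
      let T : DecoratedCospanCat F ⥤ DecoratedCospanCat G :=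
        { obj := fun X => ⟨A.obj X.as⟩
          map := fun f => DecoratedCospanCat.mapHom A B θ f
          map_id := map_id
          map_comp := map_comp }
      ∃ _ : T.Braided,
        IsHypergraphFunctor T ∧
        ε T = (DecoratedCospanCat.embed G).map (ε A) ∧
        (∀ X Y : DecoratedCospanCat F,
          μ T X Y = (DecoratedCospanCat.embed G).map (μ A X.as Y.as)) ∧
        (IsStrictMonoidal T ↔ IsStrictMonoidal A) := by
  -- The functor built in the statement unfolds to `mapFunctor A B θ`, so its structure applies as
  -- it stands and the coherence maps agree by definition.
  exact ⟨DecoratedCospanCat.mapHom_id A B θ, DecoratedCospanCat.mapHom_comp A B θ,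
    DecoratedCospanCat.mapFunctorBraided A B θ,
    DecoratedCospanCat.isHypergraphFunctor_mapFunctor A B θ, rfl, fun _ _ => rfl,
    DecoratedCospanCat.isStrictMonoidal_mapFunctor_iff A B θ⟩
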